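/- **Theorem 2.3.** Let $A\subseteq\mathbb R^d$ and let $G=\{G(s),\ s\in A\}$ be a standard (mean zero, unit variance) stationary Gaussian process with correlation function $\rho(h)=\mathrm{Corr}(G(s),G(t))$, $h=s-t$. Let $s_i,s_j\in A$ be two sites such that $\rho:=\rho(s_i-s_j)$ satisfies $|\rho|<1$. For a nonnegative process $W_\nu$ on $A$ put $Y^*_\nu(s)=W_\nu(s)^{-1/2}G(s)$. Assume that one of the following holds. (a) $\nu>2$ is an integer and $W_\nu(s)=\frac1\nu\sum_{k=1}^{\nu}G_k(s)^2$, where $G_1,\dots,G_\nu$ are copies of $G$ and $G,G_1,\dots,G_\nu$ are mutually independent. (b) $\nu>2$ is real, $W_\nu$ is independent of $G$, and $(W_\nu(s_i),W_\nu(s_j))$ has the bivariate Gamma distribution with marginals $\Gamma(\nu/2,\nu/2)$ and underlying correlation $\rho$, that is, for all $x_1,x_2\ge 0$, $$\mathbb E\, e^{-x_1W_\nu(s_i)-x_2W_\nu(s_j)}=\Big[\big(1+\tfrac{2x_1}{\nu}\big)\big(1+\tfrac{2x_2}{\nu}\big)-\tfrac{4\rho^2x_1x_2}{\nu^2}\Big]^{-\nu/2}.$$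 Let $$F_4(a,b;c,c';w,z)=\sum_{k=0}^\infty\sum_{m=0}^\infty\frac{(a)_{k+m}(b)_{k+m}\,w^kz^m}{k!\,m!\,(c)_k(c')_m},\qquad \sqrt{|w|}+\sqrt{|z|}<1,$$ be Appell's hypergeometric function of the fourth type, with $(s)_k=\Gamma(s+k)/\Gamma(s)$, and let $l_{ij}=(y_i^2+\nu)(y_j^2+\nu)$. Then for all real $y_i,y_j$ one has $\sqrt{\rho^2y_i^2y_j^2/l_{ij}}+\sqrt{\nu^2\rho^2/l_{ij}}<1$, the two double series below converge absolutely, and the random vector $(Y^*_\nu(s_i),Y^*_\nu(s_j))$ has the probability density $$\begin{aligned}f(y_i,y_j)={}&\frac{\nu^{\nu}\,l_{ij}^{-(\nu+1)/2}\,\Gamma^2\!\left(\frac{\nu+1}{2}\right)}{\pi\,\Gamma^2\!\left(\frac{\nu}{2}\right)(1-\rho^2)^{-(\nu+1)/2}}\,F_4\!\left(\tfrac{\nu+1}{2},\tfrac{\nu+1}{2};\tfrac12,\tfrac{\nu}{2};\tfrac{\rho^2y_i^2y_j^2}{l_{ij}},\tfrac{\nu^2\rho^2}{l_{ij}}\right)\\&+\frac{\rho\,y_iy_j\,\nu^{\nu+2}\,l_{ij}^{-\nu/2-1}}{2\pi\,(1-\rho^2)^{-(\nu+1)/2}}\,F_4\!\left(\tfrac{\nu}{2}+1,\tfrac{\nu}{2}+1;\tfrac32,\tfrac{\nu}{2};\tfrac{\rho^2y_i^2y_j^2}{l_{ij}},\tfrac{\nu^2\rho^2}{l_{ij}}\right)\end{aligned}$$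 with respect to Lebesgue measure on $\mathbb R^2$. -/

import Mathlib

open MeasureTheory ProbabilityTheory

noncomputable section

/-- The general term of the double series defining Appell's hypergeometric function of the fourth
type, `(a)_{k+m} (b)_{k+m} w^k z^m / (k! m! (c)_k (c')_m)`, where
`(s)_k = s (s + 1) ⋯ (s + k - 1)` is the Pochhammer symbol. -/
def appellF4Term (a b c c' w z : ℝ) (k m : ℕ) : ℝ :=
  ((ascPochhammer ℝ (k + m)).eval a * (ascPochhammer ℝ (k + m)).eval b * w ^ k * z ^ m) /
    ((k.factorial : ℝ) * (m.factorial : ℝ) *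
      (ascPochhammer ℝ k).eval c * (ascPochhammer ℝ m).eval c')

/-- Appell's hypergeometric function of the fourth type (meaningful for `√|w| + √|z| < 1`). -/
def appellF4 (a b c c' w z : ℝ) : ℝ :=
  ∑' k : ℕ, ∑' m : ℕ, appellF4Term a b c c' w z k m

/-- `l = (y₁² + ν) (y₂² + ν)`. -/
def tPairL (ν : ℝ) (y : ℝ × ℝ) : ℝ := (y.1 ^ 2 + ν) * (y.2 ^ 2 + ν)

/-- The first `F₄` argument, `r² y₁² y₂² / l`. -/
def tPairArg₁ (ν r : ℝ) (y : ℝ × ℝ) : ℝ := r ^ 2 * y.1 ^ 2 * y.2 ^ 2 / tPairL ν y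

/-- The second `F₄` argument, `ν² r² / l`. -/
def tPairArg₂ (ν r : ℝ) (y : ℝ × ℝ) : ℝ := ν ^ 2 * r ^ 2 / tPairL ν y

/-- The closed-form bivariate function of the pair `y`, with `ν` degrees of freedom and underlying
correlation `r`: a sum of two terms, each containing a value of Appell's `F₄`. -/
def tPairDensity (ν r : ℝ) (y : ℝ × ℝ) : ℝ :=
  (ν ^ ν * tPairL ν y ^ (-((ν + 1) / 2)) * Real.Gamma ((ν + 1) / 2) ^ 2) /
      (Real.pi * Real.Gamma (ν / 2) ^ 2 * (1 - r ^ 2) ^ (-((ν + 1) / 2))) *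
    appellF4 ((ν + 1) / 2) ((ν + 1) / 2) (1 / 2) (ν / 2) (tPairArg₁ ν r y) (tPairArg₂ ν r y)
  + (r * y.1 * y.2 * ν ^ (ν + 2) * tPairL ν y ^ (-(ν / 2) - 1)) /
      (2 * Real.pi * (1 - r ^ 2) ^ (-((ν + 1) / 2))) *
    appellF4 (ν / 2 + 1) (ν / 2 + 1) (3 / 2) (ν / 2) (tPairArg₁ ν r y) (tPairArg₂ ν r y)

/-- All `F₄` values in `tPairDensity ν r` are taken at points of the domain of `F₄`, and the double
series converge (absolutely) there. -/
def TPairSeriesConverge (ν r : ℝ) : Prop :=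
  ∀ y : ℝ × ℝ,
    √(tPairArg₁ ν r y) + √(tPairArg₂ ν r y) < 1 ∧
    Summable (fun p : ℕ × ℕ ↦ appellF4Term ((ν + 1) / 2) ((ν + 1) / 2) (1 / 2) (ν / 2)
      (tPairArg₁ ν r y) (tPairArg₂ ν r y) p.1 p.2) ∧
    Summable (fun p : ℕ × ℕ ↦ appellF4Term (ν / 2 + 1) (ν / 2 + 1) (3 / 2) (ν / 2)
      (tPairArg₁ ν r y) (tPairArg₂ ν r y) p.1 p.2)

/-- The real function `f` is a probability density function, with respect to Lebesgue measure on
the plane, of the random vector `Y`. -/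
structure HasBivariateDensity {Ω : Type*} [MeasurableSpace Ω] (Y : Ω → ℝ × ℝ) (P : Measure Ω)
    (f : ℝ × ℝ → ℝ) : Prop where
  aemeasurable : AEMeasurable Y P
  measurable_density : Measurable f
  nonneg : ∀ y, 0 ≤ f y
  map_eq : P.map Y = (volume : Measure (ℝ × ℝ)).withDensity (fun y ↦ ENNReal.ofReal (f y))

/-- A standard (mean zero, variance one) stationary Gaussian process on a set `A ⊆ ℝᵈ`, with
correlation function `ρ` of the lag vector. As the variances are one, the correlation of
`G s` and `G t` is their covariance. -/
structure IsStandardGaussianProcess {d : ℕ} {A : Set (EuclideanSpace ℝ (Fin d))} {Ω : Type*}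
    [MeasurableSpace Ω] (G : A → Ω → ℝ) (ρ : EuclideanSpace ℝ (Fin d) → ℝ) (P : Measure Ω) :
    Prop where
  isGaussianProcess : IsGaussianProcess G P
  mean_eq_zero : ∀ s, ∫ ω, G s ω ∂P = 0
  variance_eq_one : ∀ s, variance (G s) P = 1
  correlation_eq : ∀ s t : A, covariance (G s) (G t) P = ρ ((s : EuclideanSpace ℝ (Fin d)) - t)

/-- The mixing process `W_ν(s) = ∑ᵢ Gᵢ(s)² / ν` built from `ν` processes `Gᵢ`. -/
def chiSquareMixing {T Ω : Type*} {ν : ℕ} (G : Fin ν → T → Ω → ℝ) (s : T) (ω : Ω) : ℝ :=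
  (∑ i, G i s ω ^ 2) / ν

/-- The scale mixture `Y*(s) = W(s)^{-1/2} G(s)`. -/
def scaleMixture {T Ω : Type*} (W G : T → Ω → ℝ) (s : T) (ω : Ω) : ℝ :=
  W s ω ^ (-(1 / 2) : ℝ) * G s ω

/-- The pair `(W₁, W₂)` has the (Wicksell–Kibble) bivariate Gamma distribution with marginals
`Γ(ν/2, ν/2)` and underlying correlation `r`: the law on the quadrant `[0, ∞)²` with Laplace
transform `det (I + (2/ν) Ω diag(x₁, x₂))^{-ν/2}`, where `Ω` is the `2 × 2` correlation matrix with
off-diagonal entry `r`. Here `ν` is real; for integer `ν` this is the law of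
`∑ᵢ (Gᵢ(s)², Gᵢ(t)²) / ν`, and for general `ν` it is the corresponding convolution power. -/
structure HasBivariateGammaLaw {Ω : Type*} [MeasurableSpace Ω] (W₁ W₂ : Ω → ℝ) (ν r : ℝ)
    (P : Measure Ω) : Prop where
  aemeasurable₁ : AEMeasurable W₁ P
  aemeasurable₂ : AEMeasurable W₂ P
  nonneg₁ : ∀ᵐ ω ∂P, 0 ≤ W₁ ω
  nonneg₂ : ∀ᵐ ω ∂P, 0 ≤ W₂ ω
  laplace : ∀ x₁ x₂ : ℝ, 0 ≤ x₁ → 0 ≤ x₂ →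
    ∫ ω, Real.exp (-(x₁ * W₁ ω + x₂ * W₂ ω)) ∂P =
      ((1 + 2 / ν * x₁) * (1 + 2 / ν * x₂) - (2 / ν * r) ^ 2 * x₁ * x₂) ^ (-(ν / 2))

end

noncomputable section

open scoped NNReal BoundedContinuousFunction

/-! Condition on the mixing pair. Given `(W₁, W₂) = w`, the vector is a centred Gaussian pair
rescaled by `w₁^{-1/2}` and `w₂^{-1/2}`, with density `scaledGaussianPairPDF r w y`. Its only
coupling of `w₁` and `w₂` is a factor `exp (c √(w₁ w₂))`, `c = r y₁ y₂ / (1 - r²)`. The density of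
the vector is the average of this over the law of `(W₁, W₂)`.

That law is a mixture: with negative binomial weights in `m`, the two coordinates are independent
Gamma variables of shape `ν/2 + m` and rate `ν / (2 (1 - r²))`. The negative binomial series gives
the mixture the prescribed Laplace transform (`lintegral_exp_bivariateGammaMeasure`), and a Laplace
transform determines a finite measure on the quadrant (`ext_of_laplace`).

Expanding the exponential in powers of `c` (index `k`) and averaging over the mixture (index `m`)
leaves products of Gamma moments, which are the terms of `F₄`. Even powers, from `cosh`, give the
first `F₄`; odd powers, from `sinh` with `c` taken out, give the second. All terms are then
nonnegative, so Tonelli permits the exchange, and finiteness of the two averages yields convergence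
of the double series. Finiteness holds because the Gaussian exponent absorbs `cosh`
(`pairPDFEven_le`) and `W₁ W₂` has finite mean.

The chi-square case reduces to the Gamma case: averages of squares of independent Gaussian pairs
have the required Laplace transform (`hasBivariateGammaLaw_sum_sq_div`). -/

/-! ### Pochhammer symbols and the negative binomial series -/

lemma Real.Gamma_add_nat_eq_mul_ascPochhammer {s : ℝ} (hs : 0 < s) (n : ℕ) :
    Real.Gamma (s + n) = Real.Gamma s * (ascPochhammer ℝ n).eval s := by
  induction n with
  | zero => simp
  | succ n ih =>
    rw [ascPochhammer_succ_eval, ← mul_assoc, ← ih, Nat.cast_succ, ← add_assoc,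
      Real.Gamma_add_one (by positivity)]
    ring

/-- Duplication for factorials: it turns the `(2k)!` of the `cosh` series into the `k! (1/2)_k` of
`F₄`. The analogue with `3/2` serves the `sinh` series. -/
lemma four_pow_mul_factorial_mul_ascPochhammer_half (k : ℕ) :
    4 ^ k * (k.factorial : ℝ) * (ascPochhammer ℝ k).eval (1 / 2) = ((2 * k).factorial : ℝ) := by
  induction k with
  | zero => simp
  | succ k ih =>
    rw [ascPochhammer_succ_eval, show 2 * (k + 1) = 2 * k + 1 + 1 by ring, Nat.factorial_succ,
      Nat.factorial_succ, Nat.factorial_succ]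
    push_cast
    rw [← ih]
    ring

lemma four_pow_mul_factorial_mul_ascPochhammer_three_half (k : ℕ) :
    4 ^ k * (k.factorial : ℝ) * (ascPochhammer ℝ k).eval (3 / 2) =
      ((2 * k + 1).factorial : ℝ) := by
  induction k with
  | zero => simp
  | succ k ih =>
    rw [ascPochhammer_succ_eval, show 2 * (k + 1) + 1 = 2 * k + 1 + 1 + 1 by ring,
      Nat.factorial_succ k, Nat.factorial_succ (2 * k + 1 + 1), Nat.factorial_succ (2 * k + 1)]
    push_cast
    rw [← ih]
    ring

/-- The negative binomial series. -/
lemma hasSum_ascPochhammer_mul_pow (a : ℝ) {z : ℝ} (hz : |z| < 1) :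
    HasSum (fun m : ℕ ↦ (ascPochhammer ℝ m).eval a / m.factorial * z ^ m) ((1 - z) ^ (-a)) := by
  have h := (Real.one_div_one_sub_rpow_hasFPowerSeriesOnBall_zero a).hasSum (y := z)
    (by simpa [enorm_eq_nnnorm, ← NNReal.coe_lt_one] using hz)
  have h1 : 0 ≤ 1 - z := by linarith [le_abs_self z]
  simp only [zero_add, one_div, ← Real.rpow_neg h1] at h
  have e : ∀ m : ℕ, (ascPochhammer ℝ m).eval a / m.factorial * z ^ m =
      FormalMultilinearSeries.ofScalars ℝ (fun n : ℕ ↦ Ring.choose (a + n - 1) n) m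
        (fun _ ↦ z) := fun m ↦ by
    rw [FormalMultilinearSeries.ofScalars_apply_eq, smul_eq_mul, Ring.choose,
      show a + m - 1 - m + 1 = a by ring, ← Polynomial.ascPochhammer_smeval_eq_eval,
      ← Ring.factorial_nsmul_multichoose_eq_ascPochhammer, nsmul_eq_mul,
      mul_div_cancel_left₀ _ (by positivity)]
  simpa only [e] using h

/-! ### Gamma moments and termwise integration against mixtures -/

lemma lintegral_gammaMeasure (a β : ℝ) {f : ℝ → ENNReal} (hf : Measurable f) :
    ∫⁻ w, f w ∂gammaMeasure a β = ∫⁻ w in Set.Ioi 0,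
      ENNReal.ofReal (β ^ a / Real.Gamma a * w ^ (a - 1) * Real.exp (-(β * w))) * f w := by
  have hm : Measurable (gammaPDF a β) := (measurable_gammaPDFReal a β).ennreal_ofReal
  rw [gammaMeasure, lintegral_withDensity_eq_lintegral_mul _ hm hf,
    setLIntegral_congr Ioi_ae_eq_Ici, ← lintegral_indicator measurableSet_Ici]
  refine lintegral_congr fun w ↦ ?_
  by_cases hw : 0 ≤ w
  · simp [hw, gammaPDF_of_nonneg hw]
  · simp [hw, gammaPDF_of_neg (not_le.1 hw)]

/-- The factor `w^{j/2} e^{-tw}` turns the Gamma density into an unnormalised Gamma density of shape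
`a + j/2` and rate `β + t`. -/
lemma lintegral_sqrt_pow_mul_exp_gammaMeasure {a β t : ℝ} (ha : 0 < a) (hβ : 0 < β) (ht : 0 ≤ t)
    (j : ℕ) :
    ∫⁻ w, ENNReal.ofReal (√w ^ j * Real.exp (-(t * w))) ∂gammaMeasure a β =
      ENNReal.ofReal (β ^ a * (Real.Gamma (a + j / 2) / Real.Gamma a) *
        (β + t) ^ (-(a + j / 2))) := by
  have hs : 0 < a + j / 2 := by positivity
  have hb : 0 < β + t := by positivity
  have hG := Real.Gamma_pos_of_pos ha
  rw [lintegral_gammaMeasure _ _ (by fun_prop)]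
  have key := Real.integral_rpow_mul_exp_neg_mul_Ioi hs hb
  -- A non-integrable function has integral `0` by convention, so a nonzero value of the integral
  -- proves integrability.
  have hne : (1 / (β + t)) ^ (a + j / 2 : ℝ) * Real.Gamma (a + j / 2) ≠ 0 := by
    have := Real.Gamma_pos_of_pos hs
    positivity
  have hint : IntegrableOn (fun w : ℝ ↦ w ^ (a + j / 2 - 1) * Real.exp (-((β + t) * w)))
      (Set.Ioi 0) := by
    by_contra h
    rw [integral_undef h] at key
    exact hne key.symm
  have h2 : ∀ w ∈ Set.Ioi (0 : ℝ),
      ENNReal.ofReal (β ^ a / Real.Gamma a * w ^ (a - 1) * Real.exp (-(β * w))) *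
        ENNReal.ofReal (√w ^ j * Real.exp (-(t * w))) =
      ENNReal.ofReal (β ^ a / Real.Gamma a *
        (w ^ (a + j / 2 - 1) * Real.exp (-((β + t) * w)))) := by
    intro w (hw : 0 < w)
    rw [← ENNReal.ofReal_mul (by positivity)]
    congr 1
    have e1 : √w ^ j = w ^ (j / 2 : ℝ) := by
      rw [Real.sqrt_eq_rpow, ← Real.rpow_natCast, ← Real.rpow_mul hw.le]
      congr 1
      ring
    rw [e1, show a + j / 2 - 1 = (a - 1) + j / 2 by ring, Real.rpow_add hw,
      show -((β + t) * w) = -(β * w) + -(t * w) by ring, Real.exp_add]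
    ring
  rw [setLIntegral_congr_fun measurableSet_Ioi h2, ← ofReal_integral_eq_lintegral_ofReal
    (hint.const_mul _), integral_const_mul, key, one_div, Real.inv_rpow hb.le, Real.rpow_neg hb.le]
  · congr 1
    ring
  · refine (ae_restrict_iff' measurableSet_Ioi).2 (.of_forall fun w (hw : 0 < w) ↦ ?_)
    positivity

lemma ae_gammaMeasure_pos (a β : ℝ) : ∀ᵐ w ∂gammaMeasure a β, 0 < w := by
  rw [ae_iff, ← lintegral_indicator_one (by measurability), lintegral_gammaMeasure]
  · rw [setLIntegral_congr_fun (g := 0) measurableSet_Ioi]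
    · simp
    · intro w (hw : 0 < w)
      simp [hw]
  · exact measurable_one.indicator (by measurability)

/-- Tonelli over the expansion index `k` and the mixture index `m`. Summability of the double series
comes out of the finite integral, so no estimate of the terms is needed. -/
lemma lintegral_sum_smul_eq_ofReal_tsum_tsum {α : Type*} [MeasurableSpace α] {c : ℕ → ℝ}
    {μ : ℕ → Measure α} {g : ℕ → α → ℝ} {G : α → ℝ} {t : ℕ → ℕ → ℝ} (hg0 : ∀ k w, 0 ≤ g k w)
    (hgm : ∀ k, Measurable (g k)) (hG : ∀ w, HasSum (g · w) (G w)) (ht : ∀ k m, 0 ≤ t k m)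
    (h : ∀ k m, ENNReal.ofReal (c m) * ∫⁻ w, ENNReal.ofReal (g k w) ∂μ m = ENNReal.ofReal (t k m))
    (hfin : ∫⁻ w, ENNReal.ofReal (G w)
      ∂(Measure.sum fun m ↦ ENNReal.ofReal (c m) • μ m) ≠ ⊤) :
    Summable (fun p : ℕ × ℕ ↦ t p.1 p.2) ∧
      ∫⁻ w, ENNReal.ofReal (G w) ∂(Measure.sum fun m ↦ ENNReal.ofReal (c m) • μ m) =
        ENNReal.ofReal (∑' k, ∑' m, t k m) := by
  have e1 : ∀ w, ENNReal.ofReal (G w) = ∑' k, ENNReal.ofReal (g k w) := fun w ↦ by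
    rw [← (hG w).tsum_eq, ENNReal.ofReal_tsum_of_nonneg (hg0 · w) (hG w).summable]
  have e2 : ∫⁻ w, ENNReal.ofReal (G w) ∂(Measure.sum fun m ↦ ENNReal.ofReal (c m) • μ m) =
      ∑' p : ℕ × ℕ, ENNReal.ofReal (t p.1 p.2) := by
    simp_rw [e1]
    rw [lintegral_tsum fun k ↦ (hgm k).ennreal_ofReal.aemeasurable,
      ENNReal.summable.tsum_prod' fun _ ↦ ENNReal.summable]
    simp_rw [lintegral_sum_measure, lintegral_smul_measure, smul_eq_mul, h]
  have hs : Summable (fun p : ℕ × ℕ ↦ t p.1 p.2) := by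
    have := ENNReal.summable_toReal (e2 ▸ hfin)
    simpa only [ENNReal.toReal_ofReal (ht _ _)] using this
  refine ⟨hs, ?_⟩
  rw [e2, ← hs.tsum_prod]
  exact (ENNReal.ofReal_tsum_of_nonneg (fun p : ℕ × ℕ ↦ ht p.1 p.2) hs).symm

lemma lintegral_sqrt_pow_mul_exp_gammaMeasure_prod {a β t₁ t₂ : ℝ} (ha : 0 < a) (hβ : 0 < β)
    (ht₁ : 0 ≤ t₁) (ht₂ : 0 ≤ t₂) (j : ℕ) :
    ∫⁻ w, ENNReal.ofReal (√w.1 ^ j * √w.2 ^ j * Real.exp (-(t₁ * w.1 + t₂ * w.2)))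
        ∂(gammaMeasure a β).prod (gammaMeasure a β) =
      ENNReal.ofReal ((β ^ a * (Real.Gamma (a + j / 2) / Real.Gamma a)) ^ 2 *
        ((β + t₁) * (β + t₂)) ^ (-(a + j / 2))) := by
  have := isProbabilityMeasure_gammaMeasure ha hβ
  have e : ∀ w : ℝ × ℝ,
      ENNReal.ofReal (√w.1 ^ j * √w.2 ^ j * Real.exp (-(t₁ * w.1 + t₂ * w.2))) =
      ENNReal.ofReal (√w.1 ^ j * Real.exp (-(t₁ * w.1))) *
        ENNReal.ofReal (√w.2 ^ j * Real.exp (-(t₂ * w.2))) := fun w ↦ by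
    rw [← ENNReal.ofReal_mul (by positivity), neg_add, Real.exp_add]
    congr 1
    ring
  simp_rw [e]
  rw [lintegral_prod_mul (f := fun x ↦ ENNReal.ofReal (√x ^ j * Real.exp (-(t₁ * x))))
    (g := fun x ↦ ENNReal.ofReal (√x ^ j * Real.exp (-(t₂ * x)))) (by fun_prop) (by fun_prop),
    lintegral_sqrt_pow_mul_exp_gammaMeasure ha hβ ht₁,
    lintegral_sqrt_pow_mul_exp_gammaMeasure ha hβ ht₂, ← ENNReal.ofReal_mul,
    Real.mul_rpow (by positivity) (by positivity)]
  · congr 1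
    ring
  · have := Real.Gamma_pos_of_pos ha
    have := Real.Gamma_pos_of_pos (show 0 < a + j / 2 by positivity)
    positivity

/-! ### The bivariate Gamma law as a mixture -/

/-- Negative binomial weights `(1 - r²)^(ν/2) (ν/2)_m r^(2m) / m!`. -/
def negBinomialWeight (ν r : ℝ) (m : ℕ) : ℝ :=
  (1 - r ^ 2) ^ (ν / 2) * ((ascPochhammer ℝ m).eval (ν / 2) / m.factorial * (r ^ 2) ^ m)

/-- The bivariate Gamma law as a negative binomial mixture of products of Gamma laws. -/
def bivariateGammaMeasure (ν r : ℝ) : Measure (ℝ × ℝ) :=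
  Measure.sum fun m : ℕ ↦ ENNReal.ofReal (negBinomialWeight ν r m) •
    (gammaMeasure (ν / 2 + m) (ν / (2 * (1 - r ^ 2)))).prod
      (gammaMeasure (ν / 2 + m) (ν / (2 * (1 - r ^ 2))))

section

variable {ν r : ℝ}

lemma one_sub_sq_pos (hr : |r| < 1) : 0 < 1 - r ^ 2 := by
  have := (sq_lt_one_iff_abs_lt_one r).2 hr
  linarith

lemma abs_sq_lt_one (hr : |r| < 1) : |r ^ 2| < 1 := by
  rw [abs_of_nonneg (sq_nonneg r)]
  exact (sq_lt_one_iff_abs_lt_one r).2 hr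

lemma ascPochhammer_eval_nonneg {s : ℝ} (hs : 0 < s) (m : ℕ) :
    0 ≤ (ascPochhammer ℝ m).eval s := (ascPochhammer_pos m s hs).le

lemma negBinomialWeight_nonneg (hν : 0 < ν) (hr : |r| < 1) (m : ℕ) :
    0 ≤ negBinomialWeight ν r m := by
  have := one_sub_sq_pos hr
  have := ascPochhammer_eval_nonneg (half_pos hν) m
  unfold negBinomialWeight
  positivity

/-- Laplace transform of the bivariate Gamma mixture. -/
lemma lintegral_exp_bivariateGammaMeasure (hν : 0 < ν) (hr : |r| < 1) {x₁ x₂ : ℝ} (hx₁ : 0 ≤ x₁)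
    (hx₂ : 0 ≤ x₂) :
    ∫⁻ w, ENNReal.ofReal (Real.exp (-(x₁ * w.1 + x₂ * w.2))) ∂bivariateGammaMeasure ν r =
      ENNReal.ofReal (((1 + 2 / ν * x₁) * (1 + 2 / ν * x₂) -
        (2 / ν * r) ^ 2 * x₁ * x₂) ^ (-(ν / 2))) := by
  have hθ := one_sub_sq_pos hr
  set β := ν / (2 * (1 - r ^ 2)) with hβ
  have hβ0 : 0 < β := by positivity
  -- The `m`-th component has Laplace transform `u^{-(ν/2+m)}`, so the mixture sums to a negative
  -- binomial series at `r² / u`, convergent since `u ≥ 1 > r²`.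
  set u := (β + x₁) * (β + x₂) / β ^ 2 with hu
  have hu1 : 1 ≤ u := by
    rw [hu, one_le_div (by positivity)]
    nlinarith [mul_nonneg hx₁ hx₂, mul_nonneg hβ0.le hx₁, mul_nonneg hβ0.le hx₂]
  have hu0 : 0 < u := by linarith
  have hz : |r ^ 2 / u| < 1 := by
    rw [abs_of_nonneg (by positivity), div_lt_one hu0]
    linarith
  have key := ((hasSum_ascPochhammer_mul_pow (ν / 2) hz).mul_left
    ((1 - r ^ 2) ^ (ν / 2) * u ^ (-(ν / 2))))
  have e : (1 - r ^ 2) ^ (ν / 2) * u ^ (-(ν / 2)) * (1 - r ^ 2 / u) ^ (-(ν / 2)) =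
      ((1 + 2 / ν * x₁) * (1 + 2 / ν * x₂) - (2 / ν * r) ^ 2 * x₁ * x₂) ^ (-(ν / 2)) := by
    have h1 : 0 ≤ 1 - r ^ 2 / u := by linarith [le_abs_self (r ^ 2 / u)]
    rw [show (1 - r ^ 2) ^ (ν / 2) = ((1 - r ^ 2)⁻¹) ^ (-(ν / 2)) by
      rw [Real.inv_rpow hθ.le, Real.rpow_neg hθ.le, inv_inv], ← Real.mul_rpow (by positivity)
      hu0.le, ← Real.mul_rpow (by positivity) h1]
    congr 1
    rw [hu, hβ]
    have : β + x₁ ≠ 0 := by positivity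
    field_simp
    ring
  rw [e] at key
  clear_value u
  rw [bivariateGammaMeasure, lintegral_sum_measure, ← key.tsum_eq,
    ENNReal.ofReal_tsum_of_nonneg _ key.summable]
  · refine tsum_congr fun m ↦ ?_
    have hm : 0 < ν / 2 + m := by positivity
    have h0 := lintegral_sqrt_pow_mul_exp_gammaMeasure_prod hm hβ0 hx₁ hx₂ 0
    simp only [pow_zero, one_mul, Nat.cast_zero, zero_div, add_zero,
      div_self (Real.Gamma_pos_of_pos hm).ne', mul_one] at h0
    rw [lintegral_smul_measure, h0, smul_eq_mul,
      ← ENNReal.ofReal_mul (negBinomialWeight_nonneg hν hr m), negBinomialWeight]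
    congr 1
    clear_value β
    have h2 : (β ^ (ν / 2 + m)) ^ 2 * ((β + x₁) * (β + x₂)) ^ (-(ν / 2 + m)) =
        u ^ (-(ν / 2)) / u ^ m := by
      rw [← Real.rpow_natCast u, ← Real.rpow_sub hu0, show -(ν / 2) - m = -(ν / 2 + m) by ring,
        hu, Real.div_rpow (by positivity) (by positivity), ← Real.rpow_natCast,
        ← Real.rpow_mul hβ0.le, ← Real.rpow_natCast β, ← Real.rpow_mul hβ0.le,
        eq_div_iff (by positivity), mul_right_comm, ← Real.rpow_add hβ0]
      convert one_mul _ using 2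
      convert Real.rpow_zero β using 2
      push_cast
      ring
    rw [h2, div_pow]
    ring
  · intro m
    have := ascPochhammer_eval_nonneg (half_pos hν) m
    positivity

lemma isProbabilityMeasure_bivariateGammaMeasure (hν : 0 < ν) (hr : |r| < 1) :
    IsProbabilityMeasure (bivariateGammaMeasure ν r) := by
  -- The Laplace transform at the origin is the total mass.
  have := lintegral_exp_bivariateGammaMeasure hν hr le_rfl le_rfl
  exact ⟨by simpa using this⟩

lemma ae_bivariateGammaMeasure_pos (hν : 0 < ν) (hr : |r| < 1) :
    ∀ᵐ w ∂bivariateGammaMeasure ν r, 0 < w.1 ∧ 0 < w.2 := by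
  have hθ := one_sub_sq_pos hr
  rw [bivariateGammaMeasure, Measure.ae_sum_iff]
  intro m
  have hm : 0 < ν / 2 + m := by positivity
  have := isProbabilityMeasure_gammaMeasure hm (show 0 < ν / (2 * (1 - r ^ 2)) by positivity)
  refine Measure.ae_smul_measure (.and ?_ ?_) _
  · exact Measure.quasiMeasurePreserving_fst.ae (ae_gammaMeasure_pos _ _)
  · exact Measure.quasiMeasurePreserving_snd.ae (ae_gammaMeasure_pos _ _)

/-- Both `(a)_m (a+m)(a+m+1)` and `a(a+1) (a+2)_m` equal `(a)_{m+2}`. This bounds the second moment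
of the weights by a binomial series with parameter `a + 2`. -/
lemma ascPochhammer_eval_mul_add_sq_le {a : ℝ} (ha : 0 < a) (m : ℕ) :
    (ascPochhammer ℝ m).eval a * (a + m) ^ 2 ≤
      a * (a + 1) * (ascPochhammer ℝ m).eval (a + 2) := by
  have h1 : (ascPochhammer ℝ m).eval a * (a + m) * (a + m + 1) =
      a * (a + 1) * (ascPochhammer ℝ m).eval (a + 2) := by
    have g := Real.Gamma_add_nat_eq_mul_ascPochhammer ha m
    have g2 := Real.Gamma_add_nat_eq_mul_ascPochhammer (show 0 < a + 2 by positivity) m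
    rw [show a + 2 + m = a + m + 1 + 1 by ring, Real.Gamma_add_one (by positivity),
      Real.Gamma_add_one (by positivity), g, show a + 2 = a + 1 + 1 by ring,
      Real.Gamma_add_one (by positivity), Real.Gamma_add_one ha.ne'] at g2
    have hG := (Real.Gamma_pos_of_pos ha).ne'
    apply mul_left_cancel₀ hG
    rw [show a + 2 = a + 1 + 1 by ring]
    linear_combination g2
  rw [← h1]
  have := ascPochhammer_eval_nonneg ha m
  have : 0 ≤ (ascPochhammer ℝ m).eval a * (a + m) := by positivity
  nlinarith

/-- In the `m`-th component `W₁ W₂` has mean `((ν/2 + m)/β)²`, and the weights decay like `r^{2m}`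
up to polynomial factors. -/
lemma lintegral_mul_bivariateGammaMeasure_ne_top (hν : 0 < ν) (hr : |r| < 1) :
    ∫⁻ w, ENNReal.ofReal (√w.1 ^ 2 * √w.2 ^ 2) ∂bivariateGammaMeasure ν r ≠ ⊤ := by
  have hθ := one_sub_sq_pos hr
  set β := ν / (2 * (1 - r ^ 2)) with hβ
  have hβ0 : 0 < β := by positivity
  have hs : Summable fun m : ℕ ↦ negBinomialWeight ν r m * ((ν / 2 + m) / β) ^ 2 := by
    refine Summable.of_nonneg_of_le (fun m ↦ mul_nonneg (negBinomialWeight_nonneg hν hr m)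
      (sq_nonneg _)) (fun m ↦ ?_) ((hasSum_ascPochhammer_mul_pow (ν / 2 + 2)
      (abs_sq_lt_one hr)).summable.mul_left
      ((1 - r ^ 2) ^ (ν / 2) * (ν / 2 * (ν / 2 + 1)) / β ^ 2))
    have := ascPochhammer_eval_mul_add_sq_le (half_pos hν) m
    calc _ = (1 - r ^ 2) ^ (ν / 2) / β ^ 2 / m.factorial * (r ^ 2) ^ m *
          ((ascPochhammer ℝ m).eval (ν / 2) * (ν / 2 + m) ^ 2) := by
          rw [negBinomialWeight]; ring
      _ ≤ (1 - r ^ 2) ^ (ν / 2) / β ^ 2 / m.factorial * (r ^ 2) ^ m *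
          (ν / 2 * (ν / 2 + 1) * (ascPochhammer ℝ m).eval (ν / 2 + 2)) := by gcongr
      _ = _ := by ring
  have e : ∫⁻ w, ENNReal.ofReal (√w.1 ^ 2 * √w.2 ^ 2) ∂bivariateGammaMeasure ν r =
      ENNReal.ofReal (∑' m : ℕ, negBinomialWeight ν r m * ((ν / 2 + m) / β) ^ 2) := by
    rw [bivariateGammaMeasure, lintegral_sum_measure, ENNReal.ofReal_tsum_of_nonneg _ hs]
    · refine tsum_congr fun m ↦ ?_
      have hm : 0 < ν / 2 + m := by positivity
      have h0 := lintegral_sqrt_pow_mul_exp_gammaMeasure_prod hm hβ0 le_rfl le_rfl 2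
      simp only [zero_mul, add_zero, neg_zero, Real.exp_zero, mul_one] at h0
      rw [lintegral_smul_measure, h0, smul_eq_mul,
        ← ENNReal.ofReal_mul (negBinomialWeight_nonneg hν hr m)]
      congr 2
      have hG := (Real.Gamma_pos_of_pos hm).ne'
      have hp := (Real.rpow_pos_of_pos hβ0 (ν / 2 + m)).ne'
      rw [Nat.cast_ofNat, div_self two_ne_zero, Real.Gamma_add_one hm.ne', mul_div_cancel_right₀ _
        hG, Real.mul_rpow hβ0.le hβ0.le, Real.rpow_neg hβ0.le, Real.rpow_add_one hβ0.ne']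
      field_simp
    · exact fun m ↦ mul_nonneg (negBinomialWeight_nonneg hν hr m) (sq_nonneg _)
  rw [e]
  exact ENNReal.ofReal_ne_top

end

/-! ### Even and odd parts of the conditional density -/

section
variable {ν r : ℝ}

/-- Density at `y` of `(w₁^{-1/2} G₁, w₂^{-1/2} G₂)`, where `(G₁, G₂)` is a standard Gaussian pair
with correlation `r`. -/
def scaledGaussianPairPDF (r : ℝ) (w y : ℝ × ℝ) : ℝ :=
  (2 * Real.pi * √(1 - r ^ 2))⁻¹ * (√w.1 * √w.2) *
    Real.exp (-(y.1 ^ 2 / (2 * (1 - r ^ 2)) * w.1 + y.2 ^ 2 / (2 * (1 - r ^ 2)) * w.2)) *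
    Real.exp (r * y.1 * y.2 / (1 - r ^ 2) * (√w.1 * √w.2))

/-- Terms of even degree in the expansion of `scaledGaussianPairPDF`. -/
def pairPDFEvenTerm (r : ℝ) (y : ℝ × ℝ) (k : ℕ) (w : ℝ × ℝ) : ℝ :=
  (2 * Real.pi * √(1 - r ^ 2))⁻¹ * ((r * y.1 * y.2 / (1 - r ^ 2)) ^ (2 * k) / (2 * k).factorial) *
    (√w.1 ^ (2 * k + 1) * √w.2 ^ (2 * k + 1) *
    Real.exp (-(y.1 ^ 2 / (2 * (1 - r ^ 2)) * w.1 + y.2 ^ 2 / (2 * (1 - r ^ 2)) * w.2)))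

/-- Terms of odd degree in the expansion of `scaledGaussianPairPDF`, without the factor
`r y₁ y₂ / (1 - r²)`. -/
def pairPDFOddTerm (r : ℝ) (y : ℝ × ℝ) (k : ℕ) (w : ℝ × ℝ) : ℝ :=
  (2 * Real.pi * √(1 - r ^ 2))⁻¹ *
    ((r * y.1 * y.2 / (1 - r ^ 2)) ^ (2 * k) / (2 * k + 1).factorial) *
    (√w.1 ^ (2 * k + 2) * √w.2 ^ (2 * k + 2) *
    Real.exp (-(y.1 ^ 2 / (2 * (1 - r ^ 2)) * w.1 + y.2 ^ 2 / (2 * (1 - r ^ 2)) * w.2)))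

lemma pairPDFEvenTerm_nonneg (r : ℝ) (y : ℝ × ℝ) (k : ℕ) (w : ℝ × ℝ) :
    0 ≤ pairPDFEvenTerm r y k w := by
  have := (even_two_mul k).pow_nonneg (r * y.1 * y.2 / (1 - r ^ 2))
  unfold pairPDFEvenTerm
  positivity

lemma pairPDFOddTerm_nonneg (r : ℝ) (y : ℝ × ℝ) (k : ℕ) (w : ℝ × ℝ) :
    0 ≤ pairPDFOddTerm r y k w := by
  have := (even_two_mul k).pow_nonneg (r * y.1 * y.2 / (1 - r ^ 2))
  unfold pairPDFOddTerm
  positivity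

/-- Apart from one more factor `√(w₁ w₂)`, the terms differ only by `(2k)! ≤ (2k+1)!`; bounds on the
even part thus pass to the odd part. -/
lemma pairPDFOddTerm_le (r : ℝ) (y : ℝ × ℝ) (k : ℕ) (w : ℝ × ℝ) :
    pairPDFOddTerm r y k w ≤ √w.1 * √w.2 * pairPDFEvenTerm r y k w := by
  have := (even_two_mul k).pow_nonneg (r * y.1 * y.2 / (1 - r ^ 2))
  have hf : ((2 * k).factorial : ℝ) ≤ (2 * k + 1).factorial := by
    exact_mod_cast Nat.factorial_le (Nat.le_succ _)
  unfold pairPDFOddTerm pairPDFEvenTerm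
  calc _ ≤ (2 * Real.pi * √(1 - r ^ 2))⁻¹ *
      ((r * y.1 * y.2 / (1 - r ^ 2)) ^ (2 * k) / (2 * k).factorial) *
      (√w.1 ^ (2 * k + 2) * √w.2 ^ (2 * k + 2) *
      Real.exp (-(y.1 ^ 2 / (2 * (1 - r ^ 2)) * w.1 + y.2 ^ 2 / (2 * (1 - r ^ 2)) * w.2))) := by
        gcongr
    _ = _ := by ring

lemma hasSum_pairPDFEvenTerm (r : ℝ) (y w : ℝ × ℝ) :
    HasSum (fun k ↦ pairPDFEvenTerm r y k w)
      ((2 * Real.pi * √(1 - r ^ 2))⁻¹ * (√w.1 * √w.2) *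
      Real.exp (-(y.1 ^ 2 / (2 * (1 - r ^ 2)) * w.1 + y.2 ^ 2 / (2 * (1 - r ^ 2)) * w.2)) *
      Real.cosh (r * y.1 * y.2 / (1 - r ^ 2) * (√w.1 * √w.2))) := by
  refine ((Real.hasSum_cosh (r * y.1 * y.2 / (1 - r ^ 2) * (√w.1 * √w.2))).mul_left
    _).congr_fun ?_
  intro k
  rw [pairPDFEvenTerm, mul_pow _ (√w.1 * √w.2)]
  ring

lemma summable_pairPDFOddTerm (r : ℝ) (y w : ℝ × ℝ) :
    Summable (fun k ↦ pairPDFOddTerm r y k w) :=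
  .of_nonneg_of_le (fun k ↦ pairPDFOddTerm_nonneg r y k w) (fun k ↦ pairPDFOddTerm_le r y k w)
    ((hasSum_pairPDFEvenTerm r y w).summable.mul_left _)

/-- The even part of `scaledGaussianPairPDF`. -/
def pairPDFEven (r : ℝ) (y w : ℝ × ℝ) : ℝ := ∑' k, pairPDFEvenTerm r y k w

/-- The odd part of `scaledGaussianPairPDF`, without the factor `r y₁ y₂ / (1 - r²)`. -/
def pairPDFOdd (r : ℝ) (y w : ℝ × ℝ) : ℝ := ∑' k, pairPDFOddTerm r y k w

lemma pairPDFEven_nonneg (r : ℝ) (y w : ℝ × ℝ) : 0 ≤ pairPDFEven r y w :=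
  tsum_nonneg fun k ↦ pairPDFEvenTerm_nonneg r y k w

lemma pairPDFOdd_nonneg (r : ℝ) (y w : ℝ × ℝ) : 0 ≤ pairPDFOdd r y w :=
  tsum_nonneg fun k ↦ pairPDFOddTerm_nonneg r y k w

lemma pairPDFOdd_le (r : ℝ) (y w : ℝ × ℝ) :
    pairPDFOdd r y w ≤ √w.1 * √w.2 * pairPDFEven r y w := by
  rw [pairPDFEven, ← tsum_mul_left]
  exact (summable_pairPDFOddTerm r y w).tsum_le_tsum (fun k ↦ pairPDFOddTerm_le r y k w)
    ((hasSum_pairPDFEvenTerm r y w).summable.mul_left _)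

lemma scaledGaussianPairPDF_eq (r : ℝ) (y w : ℝ × ℝ) :
    scaledGaussianPairPDF r w y =
      pairPDFEven r y w + r * y.1 * y.2 / (1 - r ^ 2) * pairPDFOdd r y w := by
  have hodd : r * y.1 * y.2 / (1 - r ^ 2) * pairPDFOdd r y w =
      (2 * Real.pi * √(1 - r ^ 2))⁻¹ * (√w.1 * √w.2) *
      Real.exp (-(y.1 ^ 2 / (2 * (1 - r ^ 2)) * w.1 + y.2 ^ 2 / (2 * (1 - r ^ 2)) * w.2)) *
      Real.sinh (r * y.1 * y.2 / (1 - r ^ 2) * (√w.1 * √w.2)) := by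
    rw [pairPDFOdd, ← tsum_mul_left]
    refine HasSum.tsum_eq (((Real.hasSum_sinh (r * y.1 * y.2 / (1 - r ^ 2) *
      (√w.1 * √w.2))).mul_left _).congr_fun ?_)
    intro k
    rw [pairPDFOddTerm, mul_pow _ (√w.1 * √w.2)]
    ring
  rw [hodd, pairPDFEven, (hasSum_pairPDFEvenTerm r y w).tsum_eq, ← mul_add, Real.cosh_add_sinh,
    scaledGaussianPairPDF]

lemma Real.cosh_le_exp_abs (x : ℝ) : Real.cosh x ≤ Real.exp |x| := by
  rw [← Real.cosh_abs, Real.cosh_eq]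
  linarith [Real.exp_le_exp.2 (neg_le_self (abs_nonneg x))]

/-- By AM-GM and `|r| < 1` the cross term is at most the diagonal part of the Gaussian exponent, so
`cosh` of the one is absorbed by `exp` of minus the other. -/
lemma pairPDFEven_le (hr : |r| < 1) (y : ℝ × ℝ) {w : ℝ × ℝ} (hw₁ : 0 ≤ w.1) (hw₂ : 0 ≤ w.2) :
    pairPDFEven r y w ≤ (2 * Real.pi * √(1 - r ^ 2))⁻¹ * (√w.1 * √w.2) := by
  have hθ := one_sub_sq_pos hr
  rw [pairPDFEven, (hasSum_pairPDFEvenTerm r y w).tsum_eq, mul_assoc]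
  refine mul_le_of_le_one_right (by positivity) ?_
  have key : |r * y.1 * y.2 / (1 - r ^ 2) * (√w.1 * √w.2)| ≤
      y.1 ^ 2 / (2 * (1 - r ^ 2)) * w.1 + y.2 ^ 2 / (2 * (1 - r ^ 2)) * w.2 := by
    have e : |r * y.1 * y.2 / (1 - r ^ 2) * (√w.1 * √w.2)| =
        |r| * (|y.1| * √w.1 * (|y.2| * √w.2)) / (1 - r ^ 2) := by
      simp only [abs_mul, abs_div, abs_of_pos hθ, abs_of_nonneg (Real.sqrt_nonneg _)]
      ring
    have e2 : y.1 ^ 2 / (2 * (1 - r ^ 2)) * w.1 + y.2 ^ 2 / (2 * (1 - r ^ 2)) * w.2 =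
        ((|y.1| * √w.1) ^ 2 + (|y.2| * √w.2) ^ 2) / 2 / (1 - r ^ 2) := by
      rw [mul_pow, mul_pow, sq_abs, sq_abs, Real.sq_sqrt hw₁, Real.sq_sqrt hw₂]
      field_simp
    rw [e, e2]
    gcongr
    have h0 : 0 ≤ |y.1| * √w.1 * (|y.2| * √w.2) := by positivity
    nlinarith [sq_nonneg (|y.1| * √w.1 - |y.2| * √w.2)]
  rw [Real.exp_neg, inv_mul_le_one₀ (Real.exp_pos _)]
  exact (Real.cosh_le_exp_abs _).trans (Real.exp_le_exp.2 key)

lemma measurable_pairPDFEvenTerm (r : ℝ) (y : ℝ × ℝ) (k : ℕ) :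
    Measurable (pairPDFEvenTerm r y k) := by
  unfold pairPDFEvenTerm
  fun_prop

lemma measurable_pairPDFOddTerm (r : ℝ) (y : ℝ × ℝ) (k : ℕ) :
    Measurable (pairPDFOddTerm r y k) := by
  unfold pairPDFOddTerm
  fun_prop

lemma lintegral_pairPDF_ne_top (hν : 0 < ν) (hr : |r| < 1) {f : ℝ × ℝ → ℝ}
    (hf : ∀ w : ℝ × ℝ, 0 ≤ w.1 → 0 ≤ w.2 →
      f w ≤ (2 * Real.pi * √(1 - r ^ 2))⁻¹ * (1 + √w.1 ^ 2 * √w.2 ^ 2)) :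
    ∫⁻ w, ENNReal.ofReal (f w) ∂bivariateGammaMeasure ν r ≠ ⊤ := by
  have := isProbabilityMeasure_bivariateGammaMeasure hν hr
  refine ne_top_of_le_ne_top (b := ENNReal.ofReal ((2 * Real.pi * √(1 - r ^ 2))⁻¹) *
    (1 + ∫⁻ w, ENNReal.ofReal (√w.1 ^ 2 * √w.2 ^ 2) ∂bivariateGammaMeasure ν r)) ?_ ?_
  · exact ENNReal.mul_ne_top ENNReal.ofReal_ne_top
      (ENNReal.add_ne_top.2 ⟨ENNReal.one_ne_top, lintegral_mul_bivariateGammaMeasure_ne_top hν hr⟩)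
  · have h1 : (1 : ENNReal) = ∫⁻ _, 1 ∂bivariateGammaMeasure ν r := by simp
    rw [h1, ← lintegral_add_left measurable_const, ← lintegral_const_mul _ (by fun_prop)]
    refine lintegral_mono_ae ?_
    filter_upwards [ae_bivariateGammaMeasure_pos hν hr] with w hw
    rw [← ENNReal.ofReal_one, ← ENNReal.ofReal_add zero_le_one (by positivity),
      ← ENNReal.ofReal_mul (by positivity)]
    exact ENNReal.ofReal_le_ofReal (hf w hw.1.le hw.2.le)

lemma lintegral_pairPDFEven_ne_top (hν : 0 < ν) (hr : |r| < 1) (y : ℝ × ℝ) :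
    ∫⁻ w, ENNReal.ofReal (pairPDFEven r y w) ∂bivariateGammaMeasure ν r ≠ ⊤ := by
  refine lintegral_pairPDF_ne_top hν hr fun w h₁ h₂ ↦ (pairPDFEven_le hr y h₁ h₂).trans ?_
  gcongr
  nlinarith [sq_nonneg (√w.1 * √w.2 - 1)]

lemma lintegral_pairPDFOdd_ne_top (hν : 0 < ν) (hr : |r| < 1) (y : ℝ × ℝ) :
    ∫⁻ w, ENNReal.ofReal (pairPDFOdd r y w) ∂bivariateGammaMeasure ν r ≠ ⊤ := by
  refine lintegral_pairPDF_ne_top hν hr fun w h₁ h₂ ↦ (pairPDFOdd_le r y w).trans ?_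
  calc _ ≤ √w.1 * √w.2 * ((2 * Real.pi * √(1 - r ^ 2))⁻¹ * (√w.1 * √w.2)) := by
        gcongr
        exact pairPDFEven_le hr y h₁ h₂
    _ = (2 * Real.pi * √(1 - r ^ 2))⁻¹ * (√w.1 ^ 2 * √w.2 ^ 2) := by ring
    _ ≤ _ := by gcongr; linarith

/-! ### From Gamma moments to Appell series -/

lemma tPairL_pos (hν : 0 < ν) (y : ℝ × ℝ) : 0 < tPairL ν y := by
  unfold tPairL
  positivity

/-- The product of the two tilted rates is `l / (2(1-r²))²`, which cancels all powers of `2(1-r²)`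
except the `j`-th. Of the two Pochhammer symbols in `Γ(ν/2 + m)²`, one cancels against the weight
and the other becomes the `(c')_m` of `F₄`. -/
lemma negBinomialWeight_mul_gamma_moment (hν : 0 < ν) (hr : |r| < 1) (y : ℝ × ℝ) (m j : ℕ) :
    negBinomialWeight ν r m * (((ν / (2 * (1 - r ^ 2))) ^ (ν / 2 + m) *
        (Real.Gamma (ν / 2 + m + j / 2) / Real.Gamma (ν / 2 + m))) ^ 2 *
      ((ν / (2 * (1 - r ^ 2)) + y.1 ^ 2 / (2 * (1 - r ^ 2))) *
        (ν / (2 * (1 - r ^ 2)) + y.2 ^ 2 / (2 * (1 - r ^ 2)))) ^ (-(ν / 2 + m + j / 2))) =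
    (1 - r ^ 2) ^ (ν / 2) * ν ^ ν * (2 * (1 - r ^ 2)) ^ j * tPairL ν y ^ (-(ν / 2 + j / 2)) /
      Real.Gamma (ν / 2) ^ 2 * (Real.Gamma (ν / 2 + m + j / 2) ^ 2 *
      (ν ^ 2 * r ^ 2 / tPairL ν y) ^ m / (m.factorial * (ascPochhammer ℝ m).eval (ν / 2))) := by
  have hθ := one_sub_sq_pos hr
  have hl := tPairL_pos hν y
  have hP := ascPochhammer_pos m (ν / 2) (half_pos hν)
  have hG := Real.Gamma_pos_of_pos (half_pos hν)
  rw [Real.Gamma_add_nat_eq_mul_ascPochhammer (half_pos hν), negBinomialWeight,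
    show (ν / (2 * (1 - r ^ 2)) + y.1 ^ 2 / (2 * (1 - r ^ 2))) *
        (ν / (2 * (1 - r ^ 2)) + y.2 ^ 2 / (2 * (1 - r ^ 2))) =
      tPairL ν y / (2 * (1 - r ^ 2)) ^ 2 by unfold tPairL; field_simp; ring]
  have hθ2 : 0 < 2 * (1 - r ^ 2) := by positivity
  generalize 2 * (1 - r ^ 2) = s at hθ2 ⊢
  generalize tPairL ν y = l at hl ⊢
  have e1 : ((ν / s) ^ (ν / 2 + m)) ^ 2 * (l / s ^ 2) ^ (-(ν / 2 + m + j / 2)) =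
      ν ^ ν * (ν ^ 2) ^ m * s ^ j * l ^ (-(ν / 2 + j / 2)) / l ^ m := by
    have a1 : ((ν / s) ^ (ν / 2 + m)) ^ 2 = ν ^ ν * (ν ^ 2) ^ m / s ^ (ν + 2 * m) := by
      rw [← Real.rpow_natCast, ← Real.rpow_mul (by positivity), Real.div_rpow hν.le hθ2.le,
        ← pow_mul, ← Real.rpow_natCast ν, ← Real.rpow_add hν]
      congr 2 <;> (push_cast; ring)
    have a2 : (l / s ^ 2) ^ (-(ν / 2 + m + j / 2)) =
        l ^ (-(ν / 2 + j / 2)) / l ^ m * (s ^ (ν + 2 * m) * s ^ j) := by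
      rw [Real.div_rpow hl.le (by positivity), ← Real.rpow_natCast s j, ← Real.rpow_add hθ2,
        ← Real.rpow_natCast l m, ← Real.rpow_sub hl, ← Real.rpow_natCast s 2,
        ← Real.rpow_mul hθ2.le, div_eq_mul_inv, ← Real.rpow_neg hθ2.le]
      congr 2 <;> (push_cast; ring)
    rw [a1, a2]
    have := Real.rpow_pos_of_pos hθ2 (ν + 2 * m)
    field_simp
  set P := (ascPochhammer ℝ m).eval (ν / 2)
  calc _ = (1 - r ^ 2) ^ (ν / 2) * (P / m.factorial * (r ^ 2) ^ m) *
        (Real.Gamma (ν / 2 + m + j / 2) / (Real.Gamma (ν / 2) * P)) ^ 2 *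
        (((ν / s) ^ (ν / 2 + m)) ^ 2 * (l / s ^ 2) ^ (-(ν / 2 + m + j / 2))) := by ring
    _ = _ := by
      rw [e1, div_pow _ l m, mul_pow _ _ m]
      field_simp

lemma ofReal_negBinomialWeight_mul_lintegral (hν : 0 < ν) (hr : |r| < 1) (y : ℝ × ℝ) (m j : ℕ)
    {c : ℝ} (hc : 0 ≤ c) :
    ENNReal.ofReal (negBinomialWeight ν r m) * ∫⁻ w, ENNReal.ofReal (c *
      (√w.1 ^ j * √w.2 ^ j *
        Real.exp (-(y.1 ^ 2 / (2 * (1 - r ^ 2)) * w.1 + y.2 ^ 2 / (2 * (1 - r ^ 2)) * w.2))))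
      ∂(gammaMeasure (ν / 2 + m) (ν / (2 * (1 - r ^ 2)))).prod
        (gammaMeasure (ν / 2 + m) (ν / (2 * (1 - r ^ 2)))) =
    ENNReal.ofReal (c * ((1 - r ^ 2) ^ (ν / 2) * ν ^ ν * (2 * (1 - r ^ 2)) ^ j *
      tPairL ν y ^ (-(ν / 2 + j / 2)) / Real.Gamma (ν / 2) ^ 2 *
      (Real.Gamma (ν / 2 + m + j / 2) ^ 2 *
      (ν ^ 2 * r ^ 2 / tPairL ν y) ^ m / (m.factorial * (ascPochhammer ℝ m).eval (ν / 2))))) := by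
  have hθ := one_sub_sq_pos hr
  simp_rw [ENNReal.ofReal_mul hc]
  rw [lintegral_const_mul _ (by fun_prop), lintegral_sqrt_pow_mul_exp_gammaMeasure_prod
    (by positivity) (by positivity) (by positivity) (by positivity), mul_left_comm,
    ← ENNReal.ofReal_mul (negBinomialWeight_nonneg hν hr m),
    negBinomialWeight_mul_gamma_moment hν hr]

/-- Coefficient of the first `F₄` value in `tPairDensity`. -/
def tPairEvenCoeff (ν r : ℝ) (y : ℝ × ℝ) : ℝ :=
  (ν ^ ν * tPairL ν y ^ (-((ν + 1) / 2)) * Real.Gamma ((ν + 1) / 2) ^ 2) /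
      (Real.pi * Real.Gamma (ν / 2) ^ 2 * (1 - r ^ 2) ^ (-((ν + 1) / 2)))

/-- Coefficient of the second `F₄` value in `tPairDensity`, divided by `r y₁ y₂ / (1 - r²)`. -/
def tPairOddCoeff (ν r : ℝ) (y : ℝ × ℝ) : ℝ :=
  (1 - r ^ 2) * (ν ^ (ν + 2) * tPairL ν y ^ (-(ν / 2) - 1)) /
      (2 * Real.pi * (1 - r ^ 2) ^ (-((ν + 1) / 2)))

/-- Isolates the `√(1 - r²)` of the Gaussian normalisation and the `(1 - r²)^{ν/2}` of the weights,
so that these cancel as atoms. -/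
lemma one_sub_sq_rpow_neg (hr : |r| < 1) :
    (1 - r ^ 2) ^ (-((ν + 1) / 2)) = √(1 - r ^ 2) / ((1 - r ^ 2) ^ (ν / 2) * (1 - r ^ 2)) := by
  have hθ := one_sub_sq_pos hr
  rw [Real.sqrt_eq_rpow, ← Real.rpow_add_one hθ.ne', ← Real.rpow_sub hθ]
  congr 1
  ring

lemma tPairEvenCoeff_pos (hν : 0 < ν) (hr : |r| < 1) (y : ℝ × ℝ) : 0 < tPairEvenCoeff ν r y := by
  have hθ := one_sub_sq_pos hr
  have hl := tPairL_pos hν y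
  have hG := Real.Gamma_pos_of_pos (half_pos hν)
  have hG1 := Real.Gamma_pos_of_pos (show 0 < (ν + 1) / 2 by positivity)
  unfold tPairEvenCoeff
  positivity

lemma tPairOddCoeff_pos (hν : 0 < ν) (hr : |r| < 1) (y : ℝ × ℝ) : 0 < tPairOddCoeff ν r y := by
  have hθ := one_sub_sq_pos hr
  have hl := tPairL_pos hν y
  unfold tPairOddCoeff
  positivity

lemma appellF4Term_nonneg {a c c' w z : ℝ} (hc : 0 < c) (hc' : 0 < c') (hw : 0 ≤ w) (hz : 0 ≤ z)
    (k m : ℕ) : 0 ≤ appellF4Term a a c c' w z k m := by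
  have := ascPochhammer_eval_nonneg hc k
  have := ascPochhammer_eval_nonneg hc' m
  have := mul_self_nonneg ((ascPochhammer ℝ (k + m)).eval a)
  unfold appellF4Term
  positivity

lemma appellF4_nonneg {a c c' w z : ℝ} (hc : 0 < c) (hc' : 0 < c') (hw : 0 ≤ w) (hz : 0 ≤ z) :
    0 ≤ appellF4 a a c c' w z :=
  tsum_nonneg fun k ↦ tsum_nonneg fun m ↦ appellF4Term_nonneg hc hc' hw hz k m

lemma tPairArg₁_nonneg (hν : 0 < ν) (r : ℝ) (y : ℝ × ℝ) : 0 ≤ tPairArg₁ ν r y := by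
  have := tPairL_pos hν y
  unfold tPairArg₁
  positivity

lemma tPairArg₂_nonneg (hν : 0 < ν) (r : ℝ) (y : ℝ × ℝ) : 0 ≤ tPairArg₂ ν r y := by
  have := tPairL_pos hν y
  unfold tPairArg₂
  positivity

lemma tPairEven_term_eq (hν : 0 < ν) (hr : |r| < 1) (y : ℝ × ℝ) (k m : ℕ) :
    (2 * Real.pi * √(1 - r ^ 2))⁻¹ *
      ((r * y.1 * y.2 / (1 - r ^ 2)) ^ (2 * k) / (2 * k).factorial) *
    ((1 - r ^ 2) ^ (ν / 2) * ν ^ ν * (2 * (1 - r ^ 2)) ^ (2 * k + 1) *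
      tPairL ν y ^ (-(ν / 2 + (2 * k + 1 : ℕ) / 2)) / Real.Gamma (ν / 2) ^ 2 *
      (Real.Gamma (ν / 2 + m + (2 * k + 1 : ℕ) / 2) ^ 2 *
      (ν ^ 2 * r ^ 2 / tPairL ν y) ^ m / (m.factorial * (ascPochhammer ℝ m).eval (ν / 2)))) =
    tPairEvenCoeff ν r y * appellF4Term ((ν + 1) / 2) ((ν + 1) / 2) (1 / 2) (ν / 2)
      (tPairArg₁ ν r y) (tPairArg₂ ν r y) k m := by
  have hθ := one_sub_sq_pos hr
  have hl := tPairL_pos hν y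
  have hP := ascPochhammer_pos m (ν / 2) (half_pos hν)
  have hQ := ascPochhammer_pos k (1 / 2 : ℝ) one_half_pos
  have hG := Real.Gamma_pos_of_pos (half_pos hν)
  have e1 : tPairL ν y ^ (-(ν / 2 + (2 * k + 1 : ℕ) / 2)) =
      tPairL ν y ^ (-((ν + 1) / 2)) / tPairL ν y ^ k := by
    rw [← Real.rpow_natCast (tPairL ν y) k, ← Real.rpow_sub hl]
    congr 1
    push_cast
    ring
  have e2 : Real.Gamma (ν / 2 + m + (2 * k + 1 : ℕ) / 2) =
      Real.Gamma ((ν + 1) / 2) * (ascPochhammer ℝ (k + m)).eval ((ν + 1) / 2) := by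
    rw [← Real.Gamma_add_nat_eq_mul_ascPochhammer (by positivity)]
    congr 1
    push_cast
    ring
  have hs := Real.sqrt_pos.2 hθ
  have hp := Real.rpow_pos_of_pos hθ (ν / 2)
  rw [e1, e2, ← four_pow_mul_factorial_mul_ascPochhammer_half, tPairEvenCoeff,
    one_sub_sq_rpow_neg hr, appellF4Term, tPairArg₁, tPairArg₂,
    div_pow _ (tPairL ν y) k, show r ^ 2 * y.1 ^ 2 * y.2 ^ 2 = (r * y.1 * y.2) ^ 2 by ring,
    ← pow_mul, pow_succ _ (2 * k), mul_pow 2 _ (2 * k), pow_mul 2 2 k, div_pow _ _ (2 * k),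
    show (2 : ℝ) ^ 2 = 4 by norm_num]
  generalize (1 - r ^ 2) ^ (ν / 2) = t at hp ⊢
  generalize √(1 - r ^ 2) = s at hs ⊢
  field_simp

lemma tPairOdd_term_eq (hν : 0 < ν) (hr : |r| < 1) (y : ℝ × ℝ) (k m : ℕ) :
    (2 * Real.pi * √(1 - r ^ 2))⁻¹ *
      ((r * y.1 * y.2 / (1 - r ^ 2)) ^ (2 * k) / (2 * k + 1).factorial) *
    ((1 - r ^ 2) ^ (ν / 2) * ν ^ ν * (2 * (1 - r ^ 2)) ^ (2 * k + 2) *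
      tPairL ν y ^ (-(ν / 2 + (2 * k + 2 : ℕ) / 2)) / Real.Gamma (ν / 2) ^ 2 *
      (Real.Gamma (ν / 2 + m + (2 * k + 2 : ℕ) / 2) ^ 2 *
      (ν ^ 2 * r ^ 2 / tPairL ν y) ^ m / (m.factorial * (ascPochhammer ℝ m).eval (ν / 2)))) =
    tPairOddCoeff ν r y * appellF4Term (ν / 2 + 1) (ν / 2 + 1) (3 / 2) (ν / 2)
      (tPairArg₁ ν r y) (tPairArg₂ ν r y) k m := by
  have hθ := one_sub_sq_pos hr
  have hl := tPairL_pos hν y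
  have hP := ascPochhammer_pos m (ν / 2) (half_pos hν)
  have hQ := ascPochhammer_pos k (3 / 2 : ℝ) (by norm_num)
  have hG := Real.Gamma_pos_of_pos (half_pos hν)
  have e1 : tPairL ν y ^ (-(ν / 2 + (2 * k + 2 : ℕ) / 2)) =
      tPairL ν y ^ (-(ν / 2) - 1) / tPairL ν y ^ k := by
    rw [← Real.rpow_natCast (tPairL ν y) k, ← Real.rpow_sub hl]
    congr 1
    push_cast
    ring
  -- Here `j = 2k + 2` shifts the argument by the integer `k + 1`. The resulting `Γ(ν/2)²` cancels,
  -- which is why the second coefficient has no Gamma factor and carries `ν^{ν+2}`.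
  have e2 : Real.Gamma (ν / 2 + m + (2 * k + 2 : ℕ) / 2) =
      ν / 2 * Real.Gamma (ν / 2) * (ascPochhammer ℝ (k + m)).eval (ν / 2 + 1) := by
    rw [← Real.Gamma_add_one (by positivity),
      ← Real.Gamma_add_nat_eq_mul_ascPochhammer (by positivity)]
    congr 1
    push_cast
    ring
  have hs := Real.sqrt_pos.2 hθ
  have hp := Real.rpow_pos_of_pos hθ (ν / 2)
  rw [e1, e2, ← four_pow_mul_factorial_mul_ascPochhammer_three_half, tPairOddCoeff,
    one_sub_sq_rpow_neg hr, appellF4Term, tPairArg₁, tPairArg₂,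
    div_pow _ (tPairL ν y) k, show r ^ 2 * y.1 ^ 2 * y.2 ^ 2 = (r * y.1 * y.2) ^ 2 by ring,
    ← pow_mul, pow_add _ (2 * k), mul_pow 2 _ (2 * k), pow_mul 2 2 k, div_pow _ _ (2 * k),
    show (2 : ℝ) ^ 2 = 4 by norm_num, show ν ^ (ν + 2) = ν ^ ν * ν ^ 2 by
      rw [Real.rpow_add hν, Real.rpow_two]]
  generalize (1 - r ^ 2) ^ (ν / 2) = t at hp ⊢
  generalize √(1 - r ^ 2) = s at hs ⊢
  field_simp

lemma summable_and_lintegral_pairPDFEven (hν : 0 < ν) (hr : |r| < 1) (y : ℝ × ℝ) :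
    Summable (fun p : ℕ × ℕ ↦ appellF4Term ((ν + 1) / 2) ((ν + 1) / 2) (1 / 2) (ν / 2)
      (tPairArg₁ ν r y) (tPairArg₂ ν r y) p.1 p.2) ∧
    ∫⁻ w, ENNReal.ofReal (pairPDFEven r y w) ∂bivariateGammaMeasure ν r =
      ENNReal.ofReal (tPairEvenCoeff ν r y * appellF4 ((ν + 1) / 2) ((ν + 1) / 2) (1 / 2) (ν / 2)
        (tPairArg₁ ν r y) (tPairArg₂ ν r y)) := by
  have hK := tPairEvenCoeff_pos hν hr y
  have hθ := one_sub_sq_pos hr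
  obtain ⟨h1, h2⟩ := lintegral_sum_smul_eq_ofReal_tsum_tsum
    (c := negBinomialWeight ν r)
    (t := fun k m ↦ tPairEvenCoeff ν r y * appellF4Term ((ν + 1) / 2) ((ν + 1) / 2) (1 / 2)
      (ν / 2) (tPairArg₁ ν r y) (tPairArg₂ ν r y) k m)
    (pairPDFEvenTerm_nonneg r y) (measurable_pairPDFEvenTerm r y)
    (fun w ↦ (hasSum_pairPDFEvenTerm r y w).summable.hasSum)
    (fun k m ↦ mul_nonneg hK.le (appellF4Term_nonneg one_half_pos (half_pos hν)
      (tPairArg₁_nonneg hν r y) (tPairArg₂_nonneg hν r y) k m))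
    (fun k m ↦ by
      have := (even_two_mul k).pow_nonneg (r * y.1 * y.2 / (1 - r ^ 2))
      rw [← tPairEven_term_eq hν hr]
      exact ofReal_negBinomialWeight_mul_lintegral hν hr y m (2 * k + 1) (by positivity))
    (lintegral_pairPDFEven_ne_top hν hr y)
  refine ⟨(summable_mul_left_iff hK.ne').1 h1, h2.trans ?_⟩
  simp_rw [tsum_mul_left, appellF4]

lemma summable_and_lintegral_pairPDFOdd (hν : 0 < ν) (hr : |r| < 1) (y : ℝ × ℝ) :
    Summable (fun p : ℕ × ℕ ↦ appellF4Term (ν / 2 + 1) (ν / 2 + 1) (3 / 2) (ν / 2)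
      (tPairArg₁ ν r y) (tPairArg₂ ν r y) p.1 p.2) ∧
    ∫⁻ w, ENNReal.ofReal (pairPDFOdd r y w) ∂bivariateGammaMeasure ν r =
      ENNReal.ofReal (tPairOddCoeff ν r y * appellF4 (ν / 2 + 1) (ν / 2 + 1) (3 / 2) (ν / 2)
        (tPairArg₁ ν r y) (tPairArg₂ ν r y)) := by
  have hK := tPairOddCoeff_pos hν hr y
  have hθ := one_sub_sq_pos hr
  obtain ⟨h1, h2⟩ := lintegral_sum_smul_eq_ofReal_tsum_tsum
    (c := negBinomialWeight ν r)
    (t := fun k m ↦ tPairOddCoeff ν r y * appellF4Term (ν / 2 + 1) (ν / 2 + 1) (3 / 2)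
      (ν / 2) (tPairArg₁ ν r y) (tPairArg₂ ν r y) k m)
    (pairPDFOddTerm_nonneg r y) (measurable_pairPDFOddTerm r y)
    (fun w ↦ (summable_pairPDFOddTerm r y w).hasSum)
    (fun k m ↦ mul_nonneg hK.le (appellF4Term_nonneg (by norm_num) (half_pos hν)
      (tPairArg₁_nonneg hν r y) (tPairArg₂_nonneg hν r y) k m))
    (fun k m ↦ by
      have := (even_two_mul k).pow_nonneg (r * y.1 * y.2 / (1 - r ^ 2))
      rw [← tPairOdd_term_eq hν hr]
      exact ofReal_negBinomialWeight_mul_lintegral hν hr y m (2 * k + 2) (by positivity))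
    (lintegral_pairPDFOdd_ne_top hν hr y)
  refine ⟨(summable_mul_left_iff hK.ne').1 h1, h2.trans ?_⟩
  simp_rw [tsum_mul_left, appellF4]

/-- The sum is `|r| (|y₁ y₂| + ν) / √l`, and Cauchy–Schwarz gives `|y₁ y₂| + ν ≤ √l`. -/
lemma sqrt_tPairArg_add_lt_one (hν : 0 < ν) (hr : |r| < 1) (y : ℝ × ℝ) :
    √(tPairArg₁ ν r y) + √(tPairArg₂ ν r y) < 1 := by
  have hl := tPairL_pos hν y
  have hs := Real.sqrt_pos.2 hl
  have e1 : √(tPairArg₁ ν r y) = |r| * |y.1 * y.2| / √(tPairL ν y) := by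
    rw [tPairArg₁, Real.sqrt_div' _ hl.le, show r ^ 2 * y.1 ^ 2 * y.2 ^ 2 =
      (r * (y.1 * y.2)) ^ 2 by ring, Real.sqrt_sq_eq_abs, abs_mul]
  have e2 : √(tPairArg₂ ν r y) = |r| * ν / √(tPairL ν y) := by
    rw [tPairArg₂, Real.sqrt_div' _ hl.le, show ν ^ 2 * r ^ 2 = (r * ν) ^ 2 by ring,
      Real.sqrt_sq_eq_abs, abs_mul, abs_of_pos hν]
  have h : |y.1 * y.2| + ν ≤ √(tPairL ν y) := by
    refine Real.le_sqrt_of_sq_le ?_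
    rw [add_sq, sq_abs, tPairL, abs_mul]
    nlinarith [sq_nonneg (|y.1| - |y.2|), sq_abs y.1, sq_abs y.2]
  rw [e1, e2, ← add_div, ← mul_add, div_lt_one hs]
  have : 0 < |y.1 * y.2| + ν := by positivity
  nlinarith

lemma tPairSeriesConverge (hν : 0 < ν) (hr : |r| < 1) : TPairSeriesConverge ν r := fun y ↦
  ⟨sqrt_tPairArg_add_lt_one hν hr y, (summable_and_lintegral_pairPDFEven hν hr y).1,
    (summable_and_lintegral_pairPDFOdd hν hr y).1⟩

lemma tPairDensity_eq (hr : |r| < 1) (y : ℝ × ℝ) :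
    tPairDensity ν r y =
      tPairEvenCoeff ν r y * appellF4 ((ν + 1) / 2) ((ν + 1) / 2) (1 / 2) (ν / 2)
        (tPairArg₁ ν r y) (tPairArg₂ ν r y) +
      r * y.1 * y.2 / (1 - r ^ 2) * (tPairOddCoeff ν r y *
        appellF4 (ν / 2 + 1) (ν / 2 + 1) (3 / 2) (ν / 2) (tPairArg₁ ν r y) (tPairArg₂ ν r y)) := by
  have hθ := one_sub_sq_pos hr
  rw [tPairDensity, tPairEvenCoeff, tPairOddCoeff]
  field_simp

lemma scaledGaussianPairPDF_nonneg (r : ℝ) (w y : ℝ × ℝ) : 0 ≤ scaledGaussianPairPDF r w y := by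
  unfold scaledGaussianPairPDF
  positivity

lemma measurable_scaledGaussianPairPDF (r : ℝ) :
    Measurable fun p : (ℝ × ℝ) × (ℝ × ℝ) ↦ scaledGaussianPairPDF r p.1 p.2 := by
  unfold scaledGaussianPairPDF
  fun_prop

/-- `tPairDensity` is the mixture of scaled Gaussian densities. -/
lemma lintegral_scaledGaussianPairPDF (hν : 0 < ν) (hr : |r| < 1) (y : ℝ × ℝ) :
    0 ≤ tPairDensity ν r y ∧
      ∫⁻ w, ENNReal.ofReal (scaledGaussianPairPDF r w y) ∂bivariateGammaMeasure ν r =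
        ENNReal.ofReal (tPairDensity ν r y) := by
  have hE := (summable_and_lintegral_pairPDFEven hν hr y).2
  have hO := (summable_and_lintegral_pairPDFOdd hν hr y).2
  have mE : Measurable (pairPDFEven r y) := by
    have : pairPDFEven r y = fun w ↦ _ := funext fun w ↦ (hasSum_pairPDFEvenTerm r y w).tsum_eq
    rw [this]
    fun_prop
  -- Recovering the odd part from `sinh` would require dividing by `c`, which may vanish; partial
  -- sums avoid this.
  have mO : Measurable (pairPDFOdd r y) :=
    measurable_of_tendsto_metrizable
      (f := fun n w ↦ ∑ k ∈ Finset.range n, pairPDFOddTerm r y k w)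
      (fun n ↦ Finset.measurable_fun_sum _ fun k _ ↦ measurable_pairPDFOddTerm r y k)
      (tendsto_pi_nhds.2 fun w ↦ (summable_pairPDFOddTerm r y w).hasSum.tendsto_sum_nat)
  have hF1 := appellF4_nonneg (a := (ν + 1) / 2) one_half_pos (half_pos hν)
    (tPairArg₁_nonneg hν r y) (tPairArg₂_nonneg hν r y)
  have hF2 := appellF4_nonneg (a := ν / 2 + 1) (show (0 : ℝ) < 3 / 2 by norm_num) (half_pos hν)
    (tPairArg₁_nonneg hν r y) (tPairArg₂_nonneg hν r y)
  have iE : Integrable (pairPDFEven r y) (bivariateGammaMeasure ν r) :=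
    ⟨mE.aestronglyMeasurable, (hasFiniteIntegral_iff_ofReal
      (.of_forall (pairPDFEven_nonneg r y))).2 (lintegral_pairPDFEven_ne_top hν hr y).lt_top⟩
  have iO : Integrable (pairPDFOdd r y) (bivariateGammaMeasure ν r) :=
    ⟨mO.aestronglyMeasurable, (hasFiniteIntegral_iff_ofReal
      (.of_forall (pairPDFOdd_nonneg r y))).2 (lintegral_pairPDFOdd_ne_top hν hr y).lt_top⟩
  -- The odd part enters with the sign of `r y₁ y₂`, so the two parts are recombined in real
  -- integrals. Nonnegativity of the closed form, not visible from its terms, then follows from that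
  -- of the conditional density.
  have hsum : ∫ w, scaledGaussianPairPDF r w y ∂bivariateGammaMeasure ν r =
      tPairDensity ν r y := by
    simp_rw [scaledGaussianPairPDF_eq]
    rw [integral_add iE (iO.const_mul _), integral_const_mul, tPairDensity_eq hr,
      integral_eq_lintegral_of_nonneg_ae (.of_forall (pairPDFEven_nonneg r y)) iE.1,
      integral_eq_lintegral_of_nonneg_ae (.of_forall (pairPDFOdd_nonneg r y)) iO.1, hE, hO,
      ENNReal.toReal_ofReal (mul_nonneg (tPairEvenCoeff_pos hν hr y).le hF1),
      ENNReal.toReal_ofReal (mul_nonneg (tPairOddCoeff_pos hν hr y).le hF2)]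
  refine ⟨hsum ▸ integral_nonneg fun w ↦ scaledGaussianPairPDF_nonneg r w y, ?_⟩
  rw [← hsum, ofReal_integral_eq_lintegral_ofReal _
    (.of_forall fun w ↦ scaledGaussianPairPDF_nonneg r w y)]
  simp_rw [scaledGaussianPairPDF_eq]
  exact iE.add (iO.const_mul _)

end

/-! ### Uniqueness of Laplace transforms on the quadrant -/

/-- The bounded continuous function `w ↦ exp (-(p₁ w₁ + p₂ w₂))` on the quadrant. -/
def quadrantExp (p : ℕ × ℕ) : (ℝ≥0 × ℝ≥0) →ᵇ ℝ :=
  .ofNormedAddCommGroup (fun w ↦ Real.exp (-(p.1 * (w.1 : ℝ) + p.2 * (w.2 : ℝ)))) (by fun_prop) 1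
    fun w ↦ by
      rw [Real.norm_eq_abs, Real.abs_exp, Real.exp_le_one_iff]
      have : 0 ≤ p.1 * (w.1 : ℝ) + p.2 * (w.2 : ℝ) := by positivity
      linarith

lemma quadrantExp_apply (p : ℕ × ℕ) (w : ℝ≥0 × ℝ≥0) :
    quadrantExp p w = Real.exp (-(p.1 * (w.1 : ℝ) + p.2 * (w.2 : ℝ))) := rfl

/-- `quadrantExp` as a monoid homomorphism. -/
def quadrantExpHom : Multiplicative (ℕ × ℕ) →* ((ℝ≥0 × ℝ≥0) →ᵇ ℝ) where
  toFun p := quadrantExp p.toAdd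
  map_one' := by ext w; simp [quadrantExp_apply]
  map_mul' p q := by
    ext w
    simp only [quadrantExp_apply, toAdd_mul, Prod.fst_add, Prod.snd_add, Nat.cast_add,
      BoundedContinuousFunction.coe_mul, Pi.mul_apply, ← Real.exp_add]
    congr 1
    ring

/-- The algebra of real exponential polynomials on the quadrant. -/
def quadrantExpPoly : StarSubalgebra ℝ ((ℝ≥0 × ℝ≥0) →ᵇ ℝ) where
  toSubalgebra := Algebra.adjoin ℝ (MonoidHom.mrange quadrantExpHom : Set _)
  star_mem' {f} hf := by
    have : star f = f := by ext; simp
    rwa [this]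

lemma quadrantExp_mem (p : ℕ × ℕ) : quadrantExp p ∈ quadrantExpPoly :=
  Algebra.subset_adjoin ⟨Multiplicative.ofAdd p, rfl⟩

/-- Exponentials with natural exponents are closed under products, so their span is an algebra; it
separates points, and such an algebra of bounded continuous functions determines a finite measure on
a Polish space. -/
lemma ext_of_integral_quadrantExp_eq {μ μ' : Measure (ℝ≥0 × ℝ≥0)} [IsFiniteMeasure μ]
    [IsFiniteMeasure μ'] (h : ∀ p, ∫ w, quadrantExp p w ∂μ = ∫ w, quadrantExp p w ∂μ') :
    μ = μ' := by
  refine ext_of_forall_mem_subalgebra_integral_eq_of_polish (𝕜 := ℝ) (A := quadrantExpPoly) ?_ ?_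
  · intro w w' hne
    have key : ∀ p : ℕ × ℕ, quadrantExp p w ≠ quadrantExp p w' →
        ∃ f ∈ (fun f : C(ℝ≥0 × ℝ≥0, ℝ) ↦ (f : ℝ≥0 × ℝ≥0 → ℝ)) ''
          (quadrantExpPoly.map (BoundedContinuousFunction.toContinuousMapStarₐ ℝ) : Set _),
          f w ≠ f w' := fun p hp ↦
      ⟨_, ⟨_, ⟨quadrantExp p, quadrantExp_mem p, rfl⟩, rfl⟩, hp⟩
    by_contra hcon
    have h1 : quadrantExp (1, 0) w = quadrantExp (1, 0) w' := by
      by_contra hp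
      exact hcon (key _ hp)
    have h2 : quadrantExp (0, 1) w = quadrantExp (0, 1) w' := by
      by_contra hp
      exact hcon (key _ hp)
    simp only [quadrantExp_apply, Nat.cast_one, Nat.cast_zero, one_mul, zero_mul, add_zero,
      zero_add, Real.exp_eq_exp, neg_inj, NNReal.coe_inj] at h1 h2
    exact hne (Prod.ext h1 h2)
  · intro g hg
    replace hg : g ∈ Submodule.span ℝ (MonoidHom.mrange quadrantExpHom : Set _) := by
      have := Algebra.adjoin_eq_span ℝ
        (MonoidHom.mrange quadrantExpHom : Set ((ℝ≥0 × ℝ≥0) →ᵇ ℝ))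
      rw [Submonoid.closure_eq] at this
      rw [← this]
      exact hg
    induction hg using Submodule.span_induction with
    | mem x hx =>
      obtain ⟨p, rfl⟩ := hx
      exact h p.toAdd
    | zero => simp
    | add x y _ _ hx hy =>
      simp only [BoundedContinuousFunction.coe_add, Pi.add_apply]
      rw [integral_add (x.integrable μ) (y.integrable μ),
        integral_add (x.integrable μ') (y.integrable μ'), hx, hy]
    | smul c x _ hx =>
      simp only [BoundedContinuousFunction.coe_smul]
      rw [integral_smul, integral_smul, hx]

/-- A finite measure on the quadrant `[0, ∞)²` is determined by its Laplace transform. -/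
lemma ext_of_laplace {μ μ' : Measure (ℝ × ℝ)} [IsFiniteMeasure μ] [IsFiniteMeasure μ']
    (hμ : ∀ᵐ w ∂μ, 0 ≤ w.1 ∧ 0 ≤ w.2) (hμ' : ∀ᵐ w ∂μ', 0 ≤ w.1 ∧ 0 ≤ w.2)
    (h : ∀ x₁ x₂ : ℝ, 0 ≤ x₁ → 0 ≤ x₂ → ∫ w, Real.exp (-(x₁ * w.1 + x₂ * w.2)) ∂μ =
      ∫ w, Real.exp (-(x₁ * w.1 + x₂ * w.2)) ∂μ') : μ = μ' := by
  -- The exponentials are bounded only on the quadrant, so the measures are moved to `ℝ≥0 × ℝ≥0`;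
  -- almost everywhere `φ` undoes `ψ`.
  let ψ : ℝ × ℝ → ℝ≥0 × ℝ≥0 := Prod.map Real.toNNReal Real.toNNReal
  let φ : ℝ≥0 × ℝ≥0 → ℝ × ℝ := Prod.map (↑) (↑)
  have mψ : Measurable ψ := by fun_prop
  have mφ : Measurable φ := by fun_prop
  have hback : ∀ κ : Measure (ℝ × ℝ), (∀ᵐ w ∂κ, 0 ≤ w.1 ∧ 0 ≤ w.2) →
      (κ.map ψ).map φ = κ := fun κ hκ ↦ by
    rw [Measure.map_map mφ mψ]
    conv_rhs => rw [← Measure.map_id (μ := κ)]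
    refine Measure.map_congr ?_
    filter_upwards [hκ] with w hw
    simp [φ, ψ, Prod.ext_iff, hw.1, hw.2]
  have hint : ∀ κ : Measure (ℝ × ℝ), (∀ᵐ w ∂κ, 0 ≤ w.1 ∧ 0 ≤ w.2) → ∀ p : ℕ × ℕ,
      ∫ w, quadrantExp p w ∂κ.map ψ = ∫ w, Real.exp (-(p.1 * w.1 + p.2 * w.2)) ∂κ :=
    fun κ hκ p ↦ by
    rw [integral_map mψ.aemeasurable (quadrantExp p).continuous.aestronglyMeasurable]
    refine integral_congr_ae ?_
    filter_upwards [hκ] with w hw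
    simp [ψ, quadrantExp_apply, hw.1, hw.2]
  have := Measure.isFiniteMeasure_map μ ψ
  have := Measure.isFiniteMeasure_map μ' ψ
  rw [← hback μ hμ, ← hback μ' hμ']
  refine congrArg (Measure.map φ) (ext_of_integral_quadrantExp_eq fun p ↦ ?_)
  rw [hint μ hμ, hint μ' hμ', h _ _ p.1.cast_nonneg p.2.cast_nonneg]

lemma HasBivariateGammaLaw.map_eq {Ω : Type*} [MeasurableSpace Ω] {P : Measure Ω}
    [IsProbabilityMeasure P] {W₁ W₂ : Ω → ℝ} {ν r : ℝ} (h : HasBivariateGammaLaw W₁ W₂ ν r P)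
    (hν : 0 < ν) (hr : |r| < 1) :
    P.map (fun ω ↦ (W₁ ω, W₂ ω)) = bivariateGammaMeasure ν r := by
  have := isProbabilityMeasure_bivariateGammaMeasure hν hr
  have hW := h.aemeasurable₁.prodMk h.aemeasurable₂
  have := Measure.isFiniteMeasure_map P (fun ω ↦ (W₁ ω, W₂ ω))
  refine ext_of_laplace ?_ ?_ fun x₁ x₂ h₁ h₂ ↦ ?_
  · rw [ae_map_iff hW (by measurability)]
    filter_upwards [h.nonneg₁, h.nonneg₂] with ω h₁ h₂ using ⟨h₁, h₂⟩
  · filter_upwards [ae_bivariateGammaMeasure_pos hν hr] with w hw using ⟨hw.1.le, hw.2.le⟩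
  · rw [integral_map hW (by fun_prop), h.laplace x₁ x₂ h₁ h₂,
      integral_eq_lintegral_of_nonneg_ae (.of_forall fun _ ↦ (Real.exp_pos _).le) (by fun_prop),
      lintegral_exp_bivariateGammaMeasure hν hr h₁ h₂, ENNReal.toReal_ofReal]
    refine Real.rpow_nonneg ?_ _
    have h3 : (2 / ν * r) ^ 2 * x₁ * x₂ ≤ (2 / ν * x₁) * (2 / ν * x₂) := by
      have hr2 : r ^ 2 ≤ 1 := by linarith [one_sub_sq_pos hr]
      calc (2 / ν * r) ^ 2 * x₁ * x₂ = r ^ 2 * ((2 / ν * x₁) * (2 / ν * x₂)) := by ring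
        _ ≤ _ := mul_le_of_le_one_left (by positivity) hr2
    have : 0 ≤ 2 / ν * x₁ := by positivity
    have : 0 ≤ 2 / ν * x₂ := by positivity
    nlinarith

/-! ### Gaussian pairs and the mixture density -/

section
variable {Ω : Type*} [MeasurableSpace Ω] {P : Measure Ω} {X Y : Ω → ℝ} {r : ℝ}

/-- The pair `(X, Y)` is a standard bivariate Gaussian with correlation `r`. -/
structure IsStandardGaussianPair (X Y : Ω → ℝ) (r : ℝ) (P : Measure Ω) : Prop where
  hasGaussianLaw : HasGaussianLaw (fun ω ↦ (X ω, Y ω)) P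
  mean_fst : ∫ ω, X ω ∂P = 0
  mean_snd : ∫ ω, Y ω ∂P = 0
  variance_fst : variance X P = 1
  variance_snd : variance Y P = 1
  covariance : covariance X Y P = r

lemma IsStandardGaussianProcess.isStandardGaussianPair {d : ℕ}
    {A : Set (EuclideanSpace ℝ (Fin d))} {G : A → Ω → ℝ} {ρ : EuclideanSpace ℝ (Fin d) → ℝ}
    (hproc : IsStandardGaussianProcess G ρ P) (s t : A) :
    IsStandardGaussianPair (G s) (G t) (ρ ((s : EuclideanSpace ℝ (Fin d)) - t)) P :=
  ⟨hproc.isGaussianProcess.hasGaussianLaw_prodMk, hproc.mean_eq_zero s,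
    hproc.mean_eq_zero t, hproc.variance_eq_one s, hproc.variance_eq_one t,
    hproc.correlation_eq s t⟩

/-- `Y` is `r X` plus an independent centred Gaussian variable of variance `1 - r²`. -/
lemma IsStandardGaussianPair.map_eq (h : IsStandardGaussianPair X Y r P) (hr : |r| < 1) :
    P.map (fun ω ↦ (X ω, Y ω)) =
      ((gaussianReal 0 1).prod (gaussianReal 0 (1 - r ^ 2).toNNReal)).map
        (fun p ↦ (p.1, r * p.1 + p.2)) := by
  have hθ := one_sub_sq_pos hr
  have := h.hasGaussianLaw.isProbabilityMeasure
  have gX : HasGaussianLaw X P := h.hasGaussianLaw.fst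
  have gY : HasGaussianLaw Y P := h.hasGaussianLaw.snd
  have mX := gX.memLp_two
  have mY := gY.memLp_two
  have gXZ : HasGaussianLaw (fun ω ↦ (X ω, Y ω - r * X ω)) P :=
    h.hasGaussianLaw.map_fun ((ContinuousLinearMap.fst ℝ ℝ ℝ).prod
      (ContinuousLinearMap.snd ℝ ℝ ℝ - r • ContinuousLinearMap.fst ℝ ℝ ℝ))
  have gZ : HasGaussianLaw (fun ω ↦ Y ω - r * X ω) P := gXZ.snd
  have cXZ : cov[X, fun ω ↦ Y ω - r * X ω; P] = 0 := by
    rw [covariance_fun_sub_right mX mY (mX.const_mul r), covariance_const_mul_right,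
      covariance_self gX.aemeasurable, h.variance_fst, h.covariance]
    ring
  have vZ : Var[fun ω ↦ Y ω - r * X ω; P] = 1 - r ^ 2 := by
    rw [variance_fun_sub mY (mX.const_mul r), variance_const_mul, covariance_const_mul_right,
      covariance_comm, h.covariance, h.variance_fst, h.variance_snd]
    ring
  have mZ : ∫ ω, (Y ω - r * X ω) ∂P = 0 := by
    rw [integral_sub gY.integrable (gX.integrable.const_mul r), integral_const_mul, h.mean_fst,
      h.mean_snd]
    simp
  -- Jointly Gaussian and uncorrelated variables are independent.
  have ind : IndepFun X (fun ω ↦ Y ω - r * X ω) P := gXZ.indepFun_of_covariance_eq_zero cXZ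
  have law := (indepFun_iff_map_prod_eq_prod_map_map gX.aemeasurable gZ.aemeasurable).1 ind
  rw [gX.map_eq_gaussianReal, gZ.map_eq_gaussianReal, h.mean_fst, mZ, vZ, h.variance_fst,
    Real.toNNReal_one] at law
  rw [← law, AEMeasurable.map_map_of_aemeasurable (by fun_prop) gXZ.aemeasurable]
  congr 1
  ext ω <;> simp

/-- Joint density as marginal times conditional: given the first coordinate `y₁`, the second is
Gaussian with mean `r y₁` and variance `1 - r²`. -/
lemma gaussianPDFReal_mul_gaussianPDFReal (hr : |r| < 1) (y : ℝ × ℝ) :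
    gaussianPDFReal 0 1 y.1 * gaussianPDFReal (r * y.1) (1 - r ^ 2).toNNReal y.2 =
      scaledGaussianPairPDF r (1, 1) y := by
  have hθ := one_sub_sq_pos hr
  rw [gaussianPDFReal, gaussianPDFReal, scaledGaussianPairPDF, Real.coe_toNNReal _ hθ.le,
    Real.sqrt_one, NNReal.coe_one, mul_one, mul_one, mul_one, mul_one, mul_mul_mul_comm,
    ← Real.exp_add, mul_assoc _ (Real.exp _), ← Real.exp_add,
    Real.sqrt_mul (by positivity) (1 - r ^ 2), ← mul_inv, ← mul_assoc (√(2 * Real.pi)),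
    Real.mul_self_sqrt (by positivity), mul_one, mul_one]
  congr 2
  field_simp
  ring

lemma IsStandardGaussianPair.lintegral_map (h : IsStandardGaussianPair X Y r P) (hr : |r| < 1)
    {F : ℝ × ℝ → ENNReal} (hF : Measurable F) :
    ∫⁻ p, F p ∂P.map (fun ω ↦ (X ω, Y ω)) =
      ∫⁻ p, ENNReal.ofReal (scaledGaussianPairPDF r (1, 1) p) * F p := by
  have hθ := one_sub_sq_pos hr
  have hθ' : (1 - r ^ 2).toNNReal ≠ 0 := (Real.toNNReal_pos.2 hθ).ne'
  have mS : Measurable fun p : ℝ × ℝ ↦ scaledGaussianPairPDF r (1, 1) p :=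
    (measurable_scaledGaussianPairPDF r).comp measurable_prodMk_left
  rw [h.map_eq hr, MeasureTheory.lintegral_map hF (by fun_prop), lintegral_prod _ (by fun_prop),
    Measure.volume_eq_prod, lintegral_prod _ (by fun_prop),
    gaussianReal_of_var_ne_zero 0 one_ne_zero,
    lintegral_withDensity_eq_lintegral_mul₀ (by fun_prop)
      (Measurable.lintegral_prod_right' (f := fun p : ℝ × ℝ ↦ F (p.1, r * p.1 + p.2))
        (by fun_prop)).aemeasurable]
  refine lintegral_congr fun x ↦ ?_
  have e : ∫⁻ z, F (x, r * x + z) ∂gaussianReal 0 (1 - r ^ 2).toNNReal =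
      ∫⁻ y, gaussianPDF (r * x) (1 - r ^ 2).toNNReal y * F (x, y) := by
    have := gaussianReal_map_const_add (μ := 0) (v := (1 - r ^ 2).toNNReal) (r * x)
    rw [zero_add] at this
    rw [← MeasureTheory.lintegral_map (f := fun y ↦ F (x, y)) (g := fun z ↦ r * x + z)
      (by fun_prop) (by fun_prop), this, gaussianReal_of_var_ne_zero _ hθ',
      lintegral_withDensity_eq_lintegral_mul₀ (by fun_prop) (by fun_prop)]
    rfl
  rw [Pi.mul_apply, e, ← lintegral_const_mul _ (by fun_prop)]
  refine lintegral_congr fun y ↦ ?_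
  rw [← mul_assoc, gaussianPDF, gaussianPDF, ← ENNReal.ofReal_mul (gaussianPDFReal_nonneg _ _ _),
    gaussianPDFReal_mul_gaussianPDFReal hr (x, y)]

lemma lintegral_eq_ofReal_mul_lintegral_comp_mul_left {c : ℝ} (hc : 0 < c) {f : ℝ → ENNReal}
    (hf : Measurable f) : ∫⁻ x, f x = ENNReal.ofReal c * ∫⁻ x, f (c * x) := by
  conv_lhs => rw [← Real.smul_map_volume_mul_left hc.ne']
  rw [lintegral_smul_measure, MeasureTheory.lintegral_map hf (by fun_prop), abs_of_pos hc,
    smul_eq_mul]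

lemma lintegral_prod_eq_ofReal_mul_lintegral_comp {c₁ c₂ : ℝ} (h₁ : 0 < c₁) (h₂ : 0 < c₂)
    {f : ℝ × ℝ → ENNReal} (hf : Measurable f) :
    ∫⁻ p, f p = ∫⁻ p : ℝ × ℝ, ENNReal.ofReal (c₁ * c₂) * f (c₁ * p.1, c₂ * p.2) := by
  rw [lintegral_const_mul _ (by fun_prop), Measure.volume_eq_prod, lintegral_prod _ (by fun_prop),
    lintegral_prod _ (by fun_prop), lintegral_eq_ofReal_mul_lintegral_comp_mul_left h₁
      (Measurable.lintegral_prod_right' hf), ENNReal.ofReal_mul h₁.le, mul_assoc,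
    ← lintegral_const_mul _ (Measurable.lintegral_prod_right'
      (f := fun p : ℝ × ℝ ↦ f (c₁ * p.1, c₂ * p.2)) (by fun_prop))]
  congr 1
  refine lintegral_congr fun x ↦ ?_
  exact lintegral_eq_ofReal_mul_lintegral_comp_mul_left h₂ (by fun_prop)

/-- `√w₁ √w₂` is the Jacobian of the substitution `y ↦ (√w₁ y₁, √w₂ y₂)`. -/
lemma scaledGaussianPairPDF_eq_mul (r : ℝ) {w : ℝ × ℝ} (hw₁ : 0 < w.1) (hw₂ : 0 < w.2)
    (y : ℝ × ℝ) :
    scaledGaussianPairPDF r w y =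
      √w.1 * √w.2 * scaledGaussianPairPDF r (1, 1) (√w.1 * y.1, √w.2 * y.2) := by
  simp only [scaledGaussianPairPDF, mul_pow, Real.sq_sqrt hw₁.le, Real.sq_sqrt hw₂.le,
    Real.sqrt_one, mul_one]
  rw [show w.1 * y.1 ^ 2 / (2 * (1 - r ^ 2)) = y.1 ^ 2 / (2 * (1 - r ^ 2)) * w.1 by ring,
    show w.2 * y.2 ^ 2 / (2 * (1 - r ^ 2)) = y.2 ^ 2 / (2 * (1 - r ^ 2)) * w.2 by ring,
    show r * (√w.1 * y.1) * (√w.2 * y.2) / (1 - r ^ 2) =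
      r * y.1 * y.2 / (1 - r ^ 2) * (√w.1 * √w.2) by ring]
  ring

/-- Density of the pair `(w₁^{-1/2} X, w₂^{-1/2} Y)`. -/
lemma IsStandardGaussianPair.lintegral_scaled (h : IsStandardGaussianPair X Y r P) (hr : |r| < 1)
    {F : ℝ × ℝ → ENNReal} (hF : Measurable F) {w : ℝ × ℝ} (hw₁ : 0 < w.1) (hw₂ : 0 < w.2) :
    ∫⁻ p, F (w.1 ^ (-(1 / 2) : ℝ) * p.1, w.2 ^ (-(1 / 2) : ℝ) * p.2)
        ∂P.map (fun ω ↦ (X ω, Y ω)) =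
      ∫⁻ y, ENNReal.ofReal (scaledGaussianPairPDF r w y) * F y := by
  have mS : Measurable fun p : ℝ × ℝ ↦ scaledGaussianPairPDF r (1, 1) p :=
    (measurable_scaledGaussianPairPDF r).comp measurable_prodMk_left
  have hs₁ := Real.sqrt_pos.2 hw₁
  have hs₂ := Real.sqrt_pos.2 hw₂
  have hinv : ∀ {x : ℝ}, 0 < x → ∀ z, x ^ (-(1 / 2) : ℝ) * (√x * z) = z := fun {x} hx z ↦ by
    rw [Real.rpow_neg hx.le, ← Real.sqrt_eq_rpow, inv_mul_cancel_left₀ (Real.sqrt_pos.2 hx).ne']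
  rw [h.lintegral_map hr (F := fun p ↦ F (w.1 ^ (-(1 / 2) : ℝ) * p.1, w.2 ^ (-(1 / 2) : ℝ) * p.2))
      (by fun_prop),
    lintegral_prod_eq_ofReal_mul_lintegral_comp hs₁ hs₂ (by fun_prop)]
  refine lintegral_congr fun y ↦ ?_
  rw [hinv hw₁, hinv hw₂, ← mul_assoc, ← ENNReal.ofReal_mul (by positivity),
    ← scaledGaussianPairPDF_eq_mul r hw₁ hw₂]

lemma hasBivariateDensity_tPairDensity [IsProbabilityMeasure P] {W₁ W₂ : Ω → ℝ} {ν : ℝ}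
    (hν : 0 < ν) (hr : |r| < 1) (hG : IsStandardGaussianPair X Y r P)
    (hW : HasBivariateGammaLaw W₁ W₂ ν r P)
    (hind : IndepFun (fun ω ↦ (W₁ ω, W₂ ω)) (fun ω ↦ (X ω, Y ω)) P) :
    HasBivariateDensity
      (fun ω ↦ (W₁ ω ^ (-(1 / 2) : ℝ) * X ω, W₂ ω ^ (-(1 / 2) : ℝ) * Y ω)) P
      (tPairDensity ν r) := by
  have mX : AEMeasurable X P := hG.hasGaussianLaw.fst.aemeasurable
  have mY : AEMeasurable Y P := hG.hasGaussianLaw.snd.aemeasurable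
  have mW₁ := hW.aemeasurable₁
  have mW₂ := hW.aemeasurable₂
  have := isProbabilityMeasure_bivariateGammaMeasure hν hr
  have mS := measurable_scaledGaussianPairPDF r
  have mL : Measurable fun y ↦
      ∫⁻ w, ENNReal.ofReal (scaledGaussianPairPDF r w y) ∂bivariateGammaMeasure ν r :=
    Measurable.lintegral_prod_left' (f := fun p : (ℝ × ℝ) × (ℝ × ℝ) ↦
      ENNReal.ofReal (scaledGaussianPairPDF r p.1 p.2)) mS.ennreal_ofReal
  have mT : AEMeasurable
      (fun ω ↦ (W₁ ω ^ (-(1 / 2) : ℝ) * X ω, W₂ ω ^ (-(1 / 2) : ℝ) * Y ω)) P := by fun_prop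
  refine ⟨mT, ?_, fun y ↦ (lintegral_scaledGaussianPairPDF hν hr y).1, ?_⟩
  -- Measurability of the closed form is read off the mixture integral, not off the Appell series.
  · convert mL.ennreal_toReal using 2 with y
    rw [(lintegral_scaledGaussianPairPDF hν hr y).2,
      ENNReal.toReal_ofReal (lintegral_scaledGaussianPairPDF hν hr y).1]
  simp_rw [← (lintegral_scaledGaussianPairPDF hν hr _).2]
  refine Measure.ext_of_lintegral _ fun F hF ↦ ?_
  have law := (indepFun_iff_map_prod_eq_prod_map_map (mW₁.prodMk mW₂) (mX.prodMk mY)).1 hind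
  rw [hW.map_eq hν hr] at law
  have : IsProbabilityMeasure (P.map (fun ω ↦ (X ω, Y ω))) :=
    Measure.isProbabilityMeasure_map (mX.prodMk mY)
  calc ∫⁻ y, F y ∂P.map
        (fun ω ↦ (W₁ ω ^ (-(1 / 2) : ℝ) * X ω, W₂ ω ^ (-(1 / 2) : ℝ) * Y ω))
      = ∫⁻ q, F (q.1.1 ^ (-(1 / 2) : ℝ) * q.2.1, q.1.2 ^ (-(1 / 2) : ℝ) * q.2.2)
          ∂P.map (fun ω ↦ ((W₁ ω, W₂ ω), (X ω, Y ω))) := by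
        rw [lintegral_map' hF.aemeasurable mT, lintegral_map' (by fun_prop) (by fun_prop)]
    _ = ∫⁻ w, ∫⁻ p, F (w.1 ^ (-(1 / 2) : ℝ) * p.1, w.2 ^ (-(1 / 2) : ℝ) * p.2)
          ∂P.map (fun ω ↦ (X ω, Y ω)) ∂bivariateGammaMeasure ν r := by
        rw [law, lintegral_prod _ (by fun_prop)]
    _ = ∫⁻ w, ∫⁻ y, ENNReal.ofReal (scaledGaussianPairPDF r w y) * F y
          ∂volume ∂bivariateGammaMeasure ν r := by
        refine lintegral_congr_ae ?_
        filter_upwards [ae_bivariateGammaMeasure_pos hν hr] with w hw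
        exact hG.lintegral_scaled hr hF hw.1 hw.2
    _ = ∫⁻ y, ∫⁻ w, ENNReal.ofReal (scaledGaussianPairPDF r w y) * F y
          ∂bivariateGammaMeasure ν r :=
        lintegral_lintegral_swap (by fun_prop)
    _ = _ := by
        rw [lintegral_withDensity_eq_lintegral_mul _ mL hF]
        refine lintegral_congr fun y ↦ ?_
        rw [lintegral_mul_const _ (by fun_prop), Pi.mul_apply]

end

/-! ### Chi-square mixing has the bivariate Gamma law -/

section
variable {Ω : Type*} [MeasurableSpace Ω] {P : Measure Ω} {X Y : Ω → ℝ} {r : ℝ}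

lemma integral_exp_neg_mul_add_sq_gaussianReal {b v : ℝ} (hb : 0 ≤ b) (hv : 0 < v) (m : ℝ) :
    ∫ z, Real.exp (-(b * (m + z) ^ 2)) ∂gaussianReal 0 v.toNNReal =
      (√(1 + 2 * b * v))⁻¹ * Real.exp (-(b / (1 + 2 * b * v) * m ^ 2)) := by
  have hd : 0 < 1 + 2 * b * v := by positivity
  have hB : 0 < (1 + 2 * b * v) / (2 * v) := by positivity
  rw [integral_gaussianReal_eq_integral_smul (Real.toNNReal_pos.2 hv).ne']
  -- Completing the square in `z`: the minimiser is `-2vbm / (1 + 2bv)`, and translation invariance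
  -- removes the shift.
  have e : ∀ z, gaussianPDFReal 0 v.toNNReal z • Real.exp (-(b * (m + z) ^ 2)) =
      (√(2 * Real.pi * v))⁻¹ * Real.exp (-(b / (1 + 2 * b * v) * m ^ 2)) *
        Real.exp (-((1 + 2 * b * v) / (2 * v)) *
          (z + 2 * v * b * m / (1 + 2 * b * v)) ^ 2) := fun z ↦ by
    rw [gaussianPDFReal, Real.coe_toNNReal _ hv.le, smul_eq_mul,
      mul_assoc _ (Real.exp _), mul_assoc _ (Real.exp _), ← Real.exp_add, ← Real.exp_add]
    congr 2
    field_simp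
    ring
  simp_rw [e]
  rw [integral_const_mul, integral_add_right_eq_self
    (fun z ↦ Real.exp (-((1 + 2 * b * v) / (2 * v)) * z ^ 2)), integral_gaussian,
    show Real.pi / ((1 + 2 * b * v) / (2 * v)) = 2 * Real.pi * v / (1 + 2 * b * v) by field_simp,
    Real.sqrt_div (by positivity)]
  have : √(2 * Real.pi * v) ≠ 0 := (Real.sqrt_pos.2 (by positivity)).ne'
  field_simp

/-- Joint Laplace transform of the squares of a standard Gaussian pair. -/
lemma IsStandardGaussianPair.integral_exp_neg_sq (h : IsStandardGaussianPair X Y r P)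
    (hr : |r| < 1) {x₁ x₂ : ℝ} (hx₁ : 0 ≤ x₁) (hx₂ : 0 ≤ x₂) :
    ∫ ω, Real.exp (-(x₁ * X ω ^ 2 + x₂ * Y ω ^ 2)) ∂P =
      (√((1 + 2 * x₁) * (1 + 2 * x₂) - (2 * r) ^ 2 * x₁ * x₂))⁻¹ := by
  have hθ := one_sub_sq_pos hr
  have hd : 0 < 1 + 2 * x₂ * (1 - r ^ 2) := by positivity
  have hXY := h.hasGaussianLaw.aemeasurable
  have bdd : ∀ a b : ℝ, ‖Real.exp (-(x₁ * a ^ 2 + x₂ * b ^ 2))‖ ≤ 1 := fun a b ↦ by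
    rw [Real.norm_eq_abs, Real.abs_exp, Real.exp_le_one_iff, neg_nonpos]
    positivity
  have e1 : ∫ ω, Real.exp (-(x₁ * X ω ^ 2 + x₂ * Y ω ^ 2)) ∂P =
      ∫ p, Real.exp (-(x₁ * p.1 ^ 2 + x₂ * p.2 ^ 2)) ∂P.map (fun ω ↦ (X ω, Y ω)) := by
    rw [integral_map hXY (by fun_prop)]
  rw [e1, h.map_eq hr, integral_map (by fun_prop) (by fun_prop), integral_prod]
  -- Writing `0 + x` lets the outer integral over `x` be the same Gaussian integral, with `m = 0`
  -- and `v = 1`.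
  · have e2 : ∀ x : ℝ, ∫ z, Real.exp (-(x₁ * x ^ 2 + x₂ * (r * x + z) ^ 2))
        ∂gaussianReal 0 (1 - r ^ 2).toNNReal = (√(1 + 2 * x₂ * (1 - r ^ 2)))⁻¹ *
        Real.exp (-((x₁ + x₂ / (1 + 2 * x₂ * (1 - r ^ 2)) * r ^ 2) * (0 + x) ^ 2)) := fun x ↦ by
      simp_rw [neg_add, Real.exp_add]
      rw [integral_const_mul, integral_exp_neg_mul_add_sq_gaussianReal hx₂ hθ, mul_left_comm,
        ← Real.exp_add]
      congr 2
      ring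
    simp_rw [e2]
    rw [integral_const_mul, ← Real.toNNReal_one,
      integral_exp_neg_mul_add_sq_gaussianReal (by positivity) one_pos, ← mul_assoc, ← mul_inv,
      ← Real.sqrt_mul hd.le]
    simp only [ne_eq, OfNat.ofNat_ne_zero, not_false_eq_true, zero_pow, mul_zero, neg_zero,
      Real.exp_zero, mul_one]
    congr 2
    field_simp
    ring
  · exact Integrable.of_bound (by fun_prop) 1 (.of_forall fun p ↦ bdd _ _)

/-- By independence the transform is a product of `n` equal factors, each the power `-1/2` of the
determinant at `(x₁/n, x₂/n)`. -/
lemma hasBivariateGammaLaw_sum_sq_div {n : ℕ} (hn : 0 < n) [IsProbabilityMeasure P]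
    {X Y : Fin n → Ω → ℝ} (hr : |r| < 1) (h : ∀ i, IsStandardGaussianPair (X i) (Y i) r P)
    (hind : iIndepFun (fun i ω ↦ (X i ω, Y i ω)) P) :
    HasBivariateGammaLaw (fun ω ↦ (∑ i, X i ω ^ 2) / n) (fun ω ↦ (∑ i, Y i ω ^ 2) / n) n r P := by
  have mX : ∀ i, AEMeasurable (X i) P := fun i ↦ (h i).hasGaussianLaw.fst.aemeasurable
  have mY : ∀ i, AEMeasurable (Y i) P := fun i ↦ (h i).hasGaussianLaw.snd.aemeasurable
  have hn' : (0 : ℝ) < n := Nat.cast_pos.2 hn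
  refine ⟨by fun_prop, by fun_prop, .of_forall fun ω ↦ ?_, .of_forall fun ω ↦ ?_,
    fun x₁ x₂ hx₁ hx₂ ↦ ?_⟩
  · positivity
  · positivity
  have e : ∀ ω, Real.exp (-(x₁ * ((∑ i, X i ω ^ 2) / n) + x₂ * ((∑ i, Y i ω ^ 2) / n))) =
      ∏ i, (fun p : ℝ × ℝ ↦ Real.exp (-(x₁ / n * p.1 ^ 2 + x₂ / n * p.2 ^ 2))) (X i ω, Y i ω) :=
    fun ω ↦ by
    rw [← Real.exp_sum, Finset.sum_neg_distrib, Finset.sum_add_distrib, ← Finset.mul_sum,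
      ← Finset.mul_sum]
    congr 2
    ring
  rw [integral_congr_ae (.of_forall e), hind.integral_fun_prod_comp
    (f := fun _ p ↦ Real.exp (-(x₁ / n * p.1 ^ 2 + x₂ / n * p.2 ^ 2)))
    (fun i ↦ (mX i).prodMk (mY i)) (fun i ↦ by fun_prop)]
  simp_rw [(h _).integral_exp_neg_sq hr (div_nonneg hx₁ hn'.le) (div_nonneg hx₂ hn'.le)]
  have hpos : 0 ≤ (1 + 2 / n * x₁) * (1 + 2 / n * x₂) - (2 / n * r) ^ 2 * x₁ * x₂ := by
    have := one_sub_sq_pos hr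
    have e : (1 + 2 / n * x₁) * (1 + 2 / n * x₂) - (2 / n * r) ^ 2 * x₁ * x₂ =
        1 + 2 / n * x₁ + 2 / n * x₂ + (2 / n * x₁) * (2 / n * x₂) * (1 - r ^ 2) := by ring
    rw [e]
    positivity
  rw [Finset.prod_const, Finset.card_univ, Fintype.card_fin,
    show (1 + 2 * (x₁ / n)) * (1 + 2 * (x₂ / n)) - (2 * r) ^ 2 * (x₁ / n) * (x₂ / n) =
      (1 + 2 / n * x₁) * (1 + 2 / n * x₂) - (2 / n * r) ^ 2 * x₁ * x₂ by ring,
    Real.sqrt_eq_rpow, ← Real.rpow_neg hpos, ← Real.rpow_natCast, ← Real.rpow_mul hpos]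
  congr 1
  ring

/-- Functions of disjoint blocks of an independent family are independent: the mixing pair uses the
indices `1, …, n`, the parent pair only `0`. -/
lemma indepFun_sum_sq_div {n : ℕ} {X Y : Fin (n + 1) → Ω → ℝ}
    (hind : iIndepFun (fun i ω ↦ (X i ω, Y i ω)) P)
    (hmeas : ∀ i, AEMeasurable (fun ω ↦ (X i ω, Y i ω)) P) :
    IndepFun (fun ω ↦ ((∑ i : Fin n, X i.succ ω ^ 2) / (n : ℝ),
      (∑ i : Fin n, Y i.succ ω ^ 2) / (n : ℝ))) (fun ω ↦ (X 0 ω, Y 0 ω)) P := by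
  let S : Finset (Fin (n + 1)) := Finset.univ.map (Fin.succEmb n)
  have hdisj : Disjoint S {0} := by
    simp [S, Finset.disjoint_singleton_right, Fin.succ_ne_zero]
  have hsucc : ∀ i : Fin n, i.succ ∈ S := fun i ↦ by simp [S]
  let φ : (S → ℝ × ℝ) → ℝ × ℝ := fun f ↦ ((∑ i : Fin n, (f ⟨i.succ, hsucc i⟩).1 ^ 2) / (n : ℝ),
    (∑ i : Fin n, (f ⟨i.succ, hsucc i⟩).2 ^ 2) / (n : ℝ))
  let ψ : (({0} : Finset (Fin (n + 1))) → ℝ × ℝ) → ℝ × ℝ :=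
    fun f ↦ f ⟨0, Finset.mem_singleton_self 0⟩
  have hφ : Measurable φ := by fun_prop
  have hψ : Measurable ψ := measurable_pi_apply _
  exact (hind.indepFun_finset₀ S {0} hdisj hmeas).comp hφ hψ

end

end

/-- Bivariate density of the standard `t` process at two sites whose underlying correlation is not
`±1`. First part: `ν > 2` is an integer, `G 0` is the parent Gaussian process and
`G 1, …, G ν` are the independent copies of it that build the mixing process. Second part:
`ν > 2` is real and the mixing process, independent of the parent process, has the
bivariate Gamma distribution at the two sites. -/
theorem theorem2p3 {d : ℕ} {A : Set (EuclideanSpace ℝ (Fin d))}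
    (ρ : EuclideanSpace ℝ (Fin d) → ℝ) {Ω : Type*} [MeasurableSpace Ω]
    (P : Measure Ω) [IsProbabilityMeasure P] (si sj : A)
    (hρ : |ρ ((si : EuclideanSpace ℝ (Fin d)) - sj)| < 1) :
    (∀ ν : ℕ, 2 < ν → ∀ G : Fin (ν + 1) → A → Ω → ℝ,
      (∀ k, IsStandardGaussianProcess (G k) ρ P) →
      iIndepFun (fun k ω s ↦ G k s ω) P →
      TPairSeriesConverge ν (ρ ((si : EuclideanSpace ℝ (Fin d)) - sj)) ∧
      HasBivariateDensity
        (fun ω ↦ (scaleMixture (chiSquareMixing fun k : Fin ν ↦ G k.succ) (G 0) si ω,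
          scaleMixture (chiSquareMixing fun k : Fin ν ↦ G k.succ) (G 0) sj ω)) P
        (tPairDensity ν (ρ ((si : EuclideanSpace ℝ (Fin d)) - sj)))) ∧
    (∀ ν : ℝ, 2 < ν → ∀ W G : A → Ω → ℝ,
      IsStandardGaussianProcess G ρ P →
      IndepFun (fun ω s ↦ W s ω) (fun ω s ↦ G s ω) P →
      HasBivariateGammaLaw (W si) (W sj) ν (ρ ((si : EuclideanSpace ℝ (Fin d)) - sj)) P →
      TPairSeriesConverge ν (ρ ((si : EuclideanSpace ℝ (Fin d)) - sj)) ∧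
      HasBivariateDensity (fun ω ↦ (scaleMixture W G si ω, scaleMixture W G sj ω)) P
        (tPairDensity ν (ρ ((si : EuclideanSpace ℝ (Fin d)) - sj)))) := by
  refine ⟨fun ν hν G hG hind ↦ ?_, fun ν hν W G hG hind hW ↦ ?_⟩
  · have hν0 : 0 < ν := by omega
    have hν' : (0 : ℝ) < ν := Nat.cast_pos.2 hν0
    have hpair := fun k ↦ (hG k).isStandardGaussianPair si sj
    have hind2 : iIndepFun (fun k ω ↦ (G k si ω, G k sj ω)) P :=
      hind.comp (fun _ (f : A → ℝ) ↦ (f si, f sj)) fun _ ↦ by fun_prop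
    have hmeas : ∀ k, AEMeasurable (fun ω ↦ (G k si ω, G k sj ω)) P :=
      fun k ↦ (hpair k).hasGaussianLaw.aemeasurable
    have hW := hasBivariateGammaLaw_sum_sq_div hν0 hρ (fun k : Fin ν ↦ hpair k.succ)
      (hind2.precomp (Fin.succ_injective ν))
    refine ⟨tPairSeriesConverge hν' hρ,
      hasBivariateDensity_tPairDensity hν' hρ (hpair 0) hW ?_⟩
    exact indepFun_sum_sq_div (X := fun k ω ↦ G k si ω) (Y := fun k ω ↦ G k sj ω) hind2 hmeas
  · have hν0 : 0 < ν := by linarith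
    exact ⟨tPairSeriesConverge hν0 hρ, hasBivariateDensity_tPairDensity hν0 hρ
      (hG.isStandardGaussianPair si sj) hW (hind.comp (φ := fun f : A → ℝ ↦ (f si, f sj))
        (ψ := fun f : A → ℝ ↦ (f si, f sj)) (by fun_prop) (by fun_prop))⟩
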